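/- Let $\mathbb H_+=\{\zeta\in\mathbb C:\operatorname{Im}\zeta>0\}$ and let $H^2(\mathbb H_+)$ be the space of analytic functions $f$ on $\mathbb H_+$ with $\|f\|:=\sup_{y>0}\|f(\cdot+iy)\|_{L^2(\mathbb R)}<\infty$ (this norm coincides with the $L^2(\mathbb R)$-norm of the boundary values of $f$). Let $0<r<1$, let $\Gamma$ be the circle of radius $r$ centered at $i$, and let $\|\cdot\|_{L^2(\Gamma)}$ be the $L^2$-norm on $\Gamma$ with respect to arc length. Put $$z_0=i\sqrt{1-r^2},\qquad m(\zeta)=\frac{\zeta-z_0}{\zeta+z_0},\qquad \rho=\frac{1-\sqrt{1-r^2}}{r},\qquad \gamma(z)=\frac{\ln|m(z)|}{\ln\rho}.$$ Theorem. The map $m$ takes $\mathbb H_+$ bijectively onto the open unit disc and $\Gamma$ onto the circle $\{|w|=\rho\}$. Let $z\in\mathbb H_+$ lie outside $\Gamma$, i.e. $|z-i|>r$. (a) There is a constant $C>0$, depending only on $r$ and $z$, such that for every $\epsilon>0$ and every $f\in H^2(\mathbb H_+)$ with $\|f\|\le1$ and $\|f\|_{L^2(\Gamma)}\le\epsilon$,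 $$|f(z)|\le C\epsilon^{\gamma(z)}.$$ (b) The bound is asymptotically optimal: there is $c>0$, independent of $\epsilon$, such that for every $0<\epsilon\le1$ some $f\in H^2(\mathbb H_+)$ satisfies $\|f\|\le1$, $\|f\|_{L^2(\Gamma)}\le\epsilon$ and $|f(z)|\ge c\,\epsilon^{\gamma(z)}$. (c) The bound is attained by $$M(\zeta)=\frac{\epsilon^{2-\gamma(z)}}{\zeta+z_0}\sum_{n=1}^\infty\frac{\bigl(\overline{m(z)}\,m(\zeta)\bigr)^n}{\epsilon^2+\rho^{2n}},\qquad \zeta\in\mathbb H_+ .$$ That is, for every $\epsilon>0$ the series converges absolutely at every $\zeta\in\mathbb H_+$ and $M\in H^2(\mathbb H_+)$, and there are positive constants $A,B,c,C'$ independent of $\epsilon$ such that $\|M\|\le A$, $\|M\|_{L^2(\Gamma)}\le B\epsilon$ and $|M(z)|\le C'\epsilon^{\gamma(z)}$ for all $\epsilon>0$, and $|M(z)|\ge c\,\epsilon^{\gamma(z)}$ for all $0<\epsilon\le1$. -/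

import Mathlib

open scoped ENNReal ComplexConjugate

noncomputable section

/-- The Hardy norm `sup_{y > 0} ‖f(· + iy)‖_{L²(ℝ)}` of a function on the upper half-plane, with
values in `[0, ∞]`; only the values of `f` on the open upper half-plane matter. -/
def hardyNorm (f : ℂ → ℂ) : ℝ≥0∞ :=
  ⨆ (y : ℝ) (_ : 0 < y),
    MeasureTheory.eLpNorm (fun x : ℝ => f ((x : ℂ) + (y : ℂ) * Complex.I)) 2 MeasureTheory.volume

/-- The Hardy space `H²(ℍ₊)`: functions analytic in the open upper half-plane whose
`L²`-norms on horizontal lines are bounded. -/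
def hardySpace : Set (ℂ → ℂ) :=
  {f | DifferentiableOn ℂ f UpperHalfPlane.upperHalfPlaneSet ∧ hardyNorm f < ⊤}

/-- The norm of `L²(Γ)`, where `Γ` is the circle with center `c` and radius `r`, with respect to
arc length: `(∫_0^{2π} |f(c + r e^{it})|² r dt)^{1/2}`, with values in `[0, ∞]`. -/
def circleL2Norm (c : ℂ) (r : ℝ) (f : ℂ → ℂ) : ℝ≥0∞ :=
  MeasureTheory.eLpNorm (fun t : ℝ => f (circleMap c r t)) 2
    (ENNReal.ofReal r • MeasureTheory.volume.restrict (Set.Ioc 0 (2 * Real.pi)))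

/-- The point `z₀ = i √(1 - r²)`. -/
def basePoint (r : ℝ) : ℂ := Complex.I * (Real.sqrt (1 - r ^ 2) : ℂ)

/-- The Möbius map `m(ζ) = (ζ - z₀) / (ζ + z₀)`. -/
def mobiusMap (r : ℝ) (ζ : ℂ) : ℂ := (ζ - basePoint r) / (ζ + basePoint r)

/-- The radius `ρ = (1 - √(1 - r²)) / r`. -/
def rhoRadius (r : ℝ) : ℝ := (1 - Real.sqrt (1 - r ^ 2)) / r

/-- The exponent `γ(z) = ln |m(z)| / ln ρ`. -/
def gammaExponent (r : ℝ) (z : ℂ) : ℝ := Real.log ‖mobiusMap r z‖ / Real.log (rhoRadius r)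

/-- The term with index `n` of the series defining the extremal function:
`(conj(m(z)) m(ζ))^n / (ε² + ρ^{2n})`. -/
def extremalTerm (r : ℝ) (z : ℂ) (ε : ℝ) (ζ : ℂ) (n : ℕ) : ℂ :=
  (conj (mobiusMap r z) * mobiusMap r ζ) ^ n / ((ε ^ 2 + rhoRadius r ^ (2 * n) : ℝ) : ℂ)

/-- The function `M(ζ) = ε^{2 - γ(z)} / (ζ + z₀) * ∑_{n ≥ 1} (conj(m(z)) m(ζ))^n / (ε² + ρ^{2n})`. -/
def extremalFunction (r : ℝ) (z : ℂ) (ε : ℝ) (ζ : ℂ) : ℂ :=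
  ((ε ^ (2 - gammaExponent r z) : ℝ) : ℂ) / (ζ + basePoint r) *
    ∑' n : ℕ, extremalTerm r z ε ζ (n + 1)

end

noncomputable section

open MeasureTheory Set Filter Topology

/-! ### Geometry of the Möbius map and the exponent. -/

section Parameters

variable {r : ℝ}

/-! The points `±z₀` are inverse to each other with respect to both the real line and `Γ`, so `m`
makes the two curves concentric. Write `s = √(1 - r²)`, `f(ζ) = g(m(ζ)) / (ζ + z₀)` and `g(w) = ∑ bₙ
wⁿ`. Since `|m'(ζ)| = 2s / |ζ + z₀|²`, the weight `1 / |ζ + z₀|²` in `|f|²` is, up to a constant,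
the Jacobian of `m` on each curve. By Parseval `‖f‖²` is a multiple of `∑ |bₙ|²` and `‖f‖²_{L²(Γ)}`
a multiple of `∑ |bₙ|² ρ²ⁿ`: both norms are diagonal in the same basis (`lintegral_comp_mobiusMap`,
`setLIntegral_comp_mobiusMap`, `lintegral_sq_norm_circleMap`).

The two constraints therefore give `∑ |bₙ|² (ε² + ρ²ⁿ) ≤ K ε²`. With `q = |m(z)| = ρ^γ`,
Cauchy–Schwarz bounds `|g(m(z))|²` by `K ε² ∑ q²ⁿ / (ε² + ρ²ⁿ)`. Because `0 < γ < 1`, the terms of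
this sum decay geometrically on both sides of the index where `ρⁿ ≈ ε`, so the sum is `O(ε^(2γ -
2))` (`exists_sum_weighted_geometric_le`) and the bound is `O(ε^γ)`. The function `M` is the
equality case of Cauchy–Schwarz, without its constant term and suitably normalized; a multiple of it
independent of `ε` gives optimality.

The remaining analysis relates the supremum over horizontal lines to the real line. For `M`, whose
power series converges beyond the unit circle, Poisson means bound every line by the boundary
(`lintegral_line_le`). A general `f` is replaced by `regularize f δ`, which is continuous up to the
real line and decays at infinity, and `δ` tends to `0` (`exists_bound`). -/

lemma sqrt_one_sub_sq_pos (hr₀ : 0 < r) (hr₁ : r < 1) : 0 < √(1 - r ^ 2) :=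
  Real.sqrt_pos.2 (by nlinarith)

lemma sq_sqrt_one_sub_sq (hr₀ : 0 < r) (hr₁ : r < 1) : √(1 - r ^ 2) ^ 2 = 1 - r ^ 2 :=
  Real.sq_sqrt (by nlinarith)

lemma sqrt_one_sub_sq_lt_one (hr₀ : 0 < r) (hr₁ : r < 1) : √(1 - r ^ 2) < 1 := by
  nlinarith [sq_sqrt_one_sub_sq hr₀ hr₁, sqrt_one_sub_sq_pos hr₀ hr₁]

lemma rhoRadius_mul (hr₀ : 0 < r) : rhoRadius r * r = 1 - √(1 - r ^ 2) := by
  rw [rhoRadius]; field_simp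

lemma rhoRadius_mul_one_add_sqrt (hr₀ : 0 < r) (hr₁ : r < 1) :
    rhoRadius r * (1 + √(1 - r ^ 2)) = r := by
  rw [rhoRadius, div_mul_eq_mul_div, div_eq_iff hr₀.ne']
  linear_combination - sq_sqrt_one_sub_sq hr₀ hr₁

lemma rhoRadius_pos (hr₀ : 0 < r) (hr₁ : r < 1) : 0 < rhoRadius r :=
  div_pos (by linarith [sqrt_one_sub_sq_lt_one hr₀ hr₁]) hr₀

lemma rhoRadius_lt_one (hr₀ : 0 < r) (hr₁ : r < 1) : rhoRadius r < 1 := by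
  nlinarith [rhoRadius_mul_one_add_sqrt hr₀ hr₁, sqrt_one_sub_sq_pos hr₀ hr₁,
    rhoRadius_pos hr₀ hr₁]

lemma rhoRadius_sq_mul (hr₀ : 0 < r) (hr₁ : r < 1) :
    rhoRadius r ^ 2 * (1 + √(1 - r ^ 2)) = 1 - √(1 - r ^ 2) := by
  rw [← rhoRadius_mul hr₀, sq, mul_assoc, rhoRadius_mul_one_add_sqrt hr₀ hr₁]

@[simp] lemma basePoint_re : (basePoint r).re = 0 := by simp [basePoint]

@[simp] lemma basePoint_im : (basePoint r).im = √(1 - r ^ 2) := by simp [basePoint]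

lemma basePoint_ne_zero (hr₀ : 0 < r) (hr₁ : r < 1) : basePoint r ≠ 0 := fun h => by
  have := congrArg Complex.im h
  simp [(sqrt_one_sub_sq_pos hr₀ hr₁).ne'] at this

lemma normSq_add_basePoint (ζ : ℂ) :
    ‖ζ + basePoint r‖ ^ 2 = ζ.re ^ 2 + (ζ.im + √(1 - r ^ 2)) ^ 2 := by
  rw [← Complex.normSq_eq_norm_sq, Complex.normSq_apply]; simp; ring

lemma normSq_sub_basePoint (ζ : ℂ) :
    ‖ζ - basePoint r‖ ^ 2 = ζ.re ^ 2 + (ζ.im - √(1 - r ^ 2)) ^ 2 := by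
  rw [← Complex.normSq_eq_norm_sq, Complex.normSq_apply]; simp; ring

lemma add_basePoint_ne_zero (hr₀ : 0 < r) (hr₁ : r < 1) {ζ : ℂ} (hζ : 0 ≤ ζ.im) :
    ζ + basePoint r ≠ 0 := fun h => by
  have := congrArg Complex.im h
  simp at this
  linarith [sqrt_one_sub_sq_pos hr₀ hr₁]

lemma norm_mobiusMap_lt_one_iff (hr₀ : 0 < r) (hr₁ : r < 1) {ζ : ℂ} (hζ : ζ + basePoint r ≠ 0) :
    ‖mobiusMap r ζ‖ < 1 ↔ 0 < ζ.im := by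
  rw [mobiusMap, norm_div, div_lt_one (norm_pos_iff.2 hζ),
    ← pow_lt_pow_iff_left₀ (norm_nonneg _) (norm_nonneg _) two_ne_zero,
    normSq_add_basePoint, normSq_sub_basePoint]
  have := sqrt_one_sub_sq_pos hr₀ hr₁
  constructor
  · intro h; by_contra h'; nlinarith
  · intro h; nlinarith

/-- `Γ` is the Apollonius circle of the points `±z₀` with ratio `ρ`. The positive factor on the
right lets one identity settle both the points on `Γ` and those outside it. -/
lemma normSq_mobiusMap_sub (hr₀ : 0 < r) (hr₁ : r < 1) (ζ : ℂ) :
    ‖ζ - basePoint r‖ ^ 2 - rhoRadius r ^ 2 * ‖ζ + basePoint r‖ ^ 2 =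
      2 * √(1 - r ^ 2) / (1 + √(1 - r ^ 2)) * (dist ζ Complex.I ^ 2 - r ^ 2) := by
  have hs := sqrt_one_sub_sq_pos hr₀ hr₁
  have hρ : rhoRadius r ^ 2 = (1 - √(1 - r ^ 2)) / (1 + √(1 - r ^ 2)) :=
    (eq_div_iff (by positivity)).2 (rhoRadius_sq_mul hr₀ hr₁)
  have hr := sq_sqrt_one_sub_sq hr₀ hr₁
  rw [normSq_add_basePoint, normSq_sub_basePoint, dist_eq_norm, ← Complex.normSq_eq_norm_sq,
    Complex.normSq_apply, hρ]
  simp only [Complex.sub_re, Complex.sub_im, Complex.I_re, Complex.I_im]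
  generalize √(1 - r ^ 2) = s at *
  rw [show r ^ 2 = 1 - s ^ 2 by linarith]
  field_simp
  ring

lemma rhoRadius_lt_norm_mobiusMap (hr₀ : 0 < r) (hr₁ : r < 1) {z : ℂ} (hz : 0 < z.im)
    (h : r < dist z Complex.I) : rhoRadius r < ‖mobiusMap r z‖ := by
  have hs := sqrt_one_sub_sq_pos hr₀ hr₁
  have hρ := rhoRadius_pos hr₀ hr₁
  rw [mobiusMap, norm_div, lt_div_iff₀ (norm_pos_iff.2 (add_basePoint_ne_zero hr₀ hr₁ hz.le)),
    ← pow_lt_pow_iff_left₀ (by positivity) (norm_nonneg _) two_ne_zero, mul_pow, ← sub_pos,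
    normSq_mobiusMap_sub hr₀ hr₁]
  have : 0 < dist z Complex.I ^ 2 - r ^ 2 := by nlinarith
  positivity

lemma norm_mobiusMap_eq_iff (hr₀ : 0 < r) (hr₁ : r < 1) {ζ : ℂ} (hζ : ζ + basePoint r ≠ 0) :
    ‖mobiusMap r ζ‖ = rhoRadius r ↔ dist ζ Complex.I = r := by
  have hs := sqrt_one_sub_sq_pos hr₀ hr₁
  have hρ := rhoRadius_pos hr₀ hr₁
  have h0 : 2 * √(1 - r ^ 2) / (1 + √(1 - r ^ 2)) ≠ 0 := by positivity
  rw [mobiusMap, norm_div, div_eq_iff (norm_ne_zero_iff.2 hζ),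
    ← pow_left_inj₀ (norm_nonneg _) (by positivity) two_ne_zero, mul_pow, ← sub_eq_zero,
    normSq_mobiusMap_sub hr₀ hr₁, mul_eq_zero, or_iff_right h0, sub_eq_zero,
    pow_left_inj₀ dist_nonneg hr₀.le two_ne_zero]

/-- The inverse `w ↦ z₀ (1 + w) / (1 - w)` of the Möbius map. -/
def mobiusInv (r : ℝ) (w : ℂ) : ℂ := basePoint r * (1 + w) / (1 - w)

lemma mobiusInv_add_basePoint {w : ℂ} (hw : w ≠ 1) :
    mobiusInv r w + basePoint r = 2 * basePoint r / (1 - w) := by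
  have : 1 - w ≠ 0 := sub_ne_zero.2 hw.symm
  rw [mobiusInv]; field_simp; ring

lemma mobiusInv_sub_basePoint {w : ℂ} (hw : w ≠ 1) :
    mobiusInv r w - basePoint r = 2 * basePoint r * w / (1 - w) := by
  have : 1 - w ≠ 0 := sub_ne_zero.2 hw.symm
  rw [mobiusInv]; field_simp; ring

lemma mobiusInv_add_basePoint_ne_zero (hr₀ : 0 < r) (hr₁ : r < 1) {w : ℂ} (hw : w ≠ 1) :
    mobiusInv r w + basePoint r ≠ 0 := by
  rw [mobiusInv_add_basePoint hw]
  exact div_ne_zero (mul_ne_zero two_ne_zero (basePoint_ne_zero hr₀ hr₁)) (sub_ne_zero.2 hw.symm)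

lemma mobiusMap_mobiusInv (hr₀ : 0 < r) (hr₁ : r < 1) {w : ℂ} (hw : w ≠ 1) :
    mobiusMap r (mobiusInv r w) = w := by
  have h0 := basePoint_ne_zero hr₀ hr₁
  have : 1 - w ≠ 0 := sub_ne_zero.2 hw.symm
  rw [mobiusMap, mobiusInv_add_basePoint hw, mobiusInv_sub_basePoint hw]
  field_simp

lemma one_sub_mobiusMap {ζ : ℂ} (hζ : ζ + basePoint r ≠ 0) :
    1 - mobiusMap r ζ = 2 * basePoint r / (ζ + basePoint r) := by
  rw [mobiusMap]; field_simp; ring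

lemma mobiusInv_mobiusMap (hr₀ : 0 < r) (hr₁ : r < 1) {ζ : ℂ} (hζ : ζ + basePoint r ≠ 0) :
    mobiusInv r (mobiusMap r ζ) = ζ := by
  have h0 := basePoint_ne_zero hr₀ hr₁
  rw [mobiusInv, one_sub_mobiusMap hζ, mobiusMap]
  field_simp
  ring

lemma mobiusInv_im_pos (hr₀ : 0 < r) (hr₁ : r < 1) {w : ℂ} (hw : ‖w‖ < 1) :
    0 < (mobiusInv r w).im := by
  have h1 : w ≠ 1 := by rintro rfl; simp at hw
  rwa [← norm_mobiusMap_lt_one_iff hr₀ hr₁ (mobiusInv_add_basePoint_ne_zero hr₀ hr₁ h1),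
    mobiusMap_mobiusInv hr₀ hr₁ h1]

lemma mobiusInv_im_nonneg (hr₀ : 0 < r) (hr₁ : r < 1) {w : ℂ} (hw : ‖w‖ ≤ 1) (hw1 : w ≠ 1) :
    0 ≤ (mobiusInv r w).im := by
  have hne := mobiusInv_add_basePoint_ne_zero hr₀ hr₁ hw1
  have hs := sqrt_one_sub_sq_pos hr₀ hr₁
  rw [← mobiusMap_mobiusInv hr₀ hr₁ hw1, mobiusMap, norm_div, div_le_one (norm_pos_iff.2 hne),
    ← pow_le_pow_iff_left₀ (norm_nonneg _) (norm_nonneg _) two_ne_zero,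
    normSq_add_basePoint, normSq_sub_basePoint] at hw
  nlinarith

lemma bijOn_mobiusMap (hr₀ : 0 < r) (hr₁ : r < 1) :
    BijOn (mobiusMap r) UpperHalfPlane.upperHalfPlaneSet (Metric.ball 0 1) := by
  refine InvOn.bijOn (f' := mobiusInv r) ⟨fun ζ hζ => ?_, fun w hw => ?_⟩ (fun ζ hζ => ?_)
    fun w hw => ?_
  · exact mobiusInv_mobiusMap hr₀ hr₁ (add_basePoint_ne_zero hr₀ hr₁ (le_of_lt hζ))
  · exact mobiusMap_mobiusInv hr₀ hr₁ (by rintro rfl; simp at hw)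
  · simpa using (norm_mobiusMap_lt_one_iff hr₀ hr₁
      (add_basePoint_ne_zero hr₀ hr₁ (le_of_lt hζ))).2 hζ
  · exact mobiusInv_im_pos hr₀ hr₁ (by simpa using hw)

lemma im_pos_of_mem_sphere (hr₁ : r < 1) {ζ : ℂ} (hζ : ζ ∈ Metric.sphere Complex.I r) :
    0 < ζ.im := by
  have h := Complex.abs_im_le_norm (ζ - Complex.I)
  rw [mem_sphere_iff_norm.1 hζ, Complex.sub_im, Complex.I_im, abs_le] at h
  linarith

lemma image_mobiusMap_sphere (hr₀ : 0 < r) (hr₁ : r < 1) :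
    mobiusMap r '' Metric.sphere Complex.I r = Metric.sphere 0 (rhoRadius r) := by
  ext w
  constructor
  · rintro ⟨ζ, hζ, rfl⟩
    have := add_basePoint_ne_zero hr₀ hr₁ (im_pos_of_mem_sphere hr₁ hζ).le
    simpa using (norm_mobiusMap_eq_iff hr₀ hr₁ this).2 hζ
  · intro hw
    have hw' : ‖w‖ = rhoRadius r := by simpa using hw
    have h1 : w ≠ 1 := by
      rintro rfl
      simp at hw'
      linarith [rhoRadius_lt_one hr₀ hr₁]
    refine ⟨mobiusInv r w, ?_, mobiusMap_mobiusInv hr₀ hr₁ h1⟩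
    exact (norm_mobiusMap_eq_iff hr₀ hr₁ (mobiusInv_add_basePoint_ne_zero hr₀ hr₁ h1)).1
      (by rwa [mobiusMap_mobiusInv hr₀ hr₁ h1])

lemma gammaExponent_pos (hr₀ : 0 < r) (hr₁ : r < 1) {z : ℂ} (hz : 0 < z.im)
    (h : r < dist z Complex.I) : 0 < gammaExponent r z := by
  have h1 := rhoRadius_lt_norm_mobiusMap hr₀ hr₁ hz h
  have h2 := (norm_mobiusMap_lt_one_iff hr₀ hr₁ (add_basePoint_ne_zero hr₀ hr₁ hz.le)).2 hz
  have h0 := rhoRadius_pos hr₀ hr₁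
  exact div_pos_of_neg_of_neg (Real.log_neg (h0.trans h1) h2)
    (Real.log_neg h0 (rhoRadius_lt_one hr₀ hr₁))

lemma gammaExponent_lt_one (hr₀ : 0 < r) (hr₁ : r < 1) {z : ℂ} (hz : 0 < z.im)
    (h : r < dist z Complex.I) : gammaExponent r z < 1 := by
  have h1 := rhoRadius_lt_norm_mobiusMap hr₀ hr₁ hz h
  have h0 := rhoRadius_pos hr₀ hr₁
  rw [gammaExponent, div_lt_one_of_neg (Real.log_neg h0 (rhoRadius_lt_one hr₀ hr₁))]
  exact Real.log_lt_log h0 h1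

/-- The relation `q = ρ^γ` is what turns powers of `q` into powers of `ε` at the index where `ρⁿ` is
close to `ε`. -/
lemma rhoRadius_rpow_gammaExponent (hr₀ : 0 < r) (hr₁ : r < 1) {z : ℂ} (hz : 0 < z.im)
    (h : r < dist z Complex.I) : rhoRadius r ^ gammaExponent r z = ‖mobiusMap r z‖ := by
  have h1 := rhoRadius_lt_norm_mobiusMap hr₀ hr₁ hz h
  have h0 := rhoRadius_pos hr₀ hr₁
  rw [Real.rpow_def_of_pos h0, gammaExponent, mul_div_cancel₀ _
    (Real.log_neg h0 (rhoRadius_lt_one hr₀ hr₁)).ne, Real.exp_log (h0.trans h1)]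

end Parameters

/-! ### Two-sided geometric estimates. -/

section GeometricSeries

/-- For `0 < κ, η < 1`, a sequence dominated by `κ ^ (k - n)` for `n ≤ k` and by `η ^ (n - k - 1)`
for `n > k` has sum at most `1 / (1 - κ) + 1 / (1 - η)`. -/
lemma sum_range_le_of_two_sided_geometric {κ η : ℝ} (hκ₀ : 0 < κ) (hκ₁ : κ < 1) (hη₀ : 0 < η)
    (hη₁ : η < 1) {h : ℕ → ℝ} (k : ℕ) (h₁ : ∀ n ≤ k, h n ≤ κ ^ (k - n))
    (h₂ : ∀ n, h (k + 1 + n) ≤ η ^ n) (h₀ : ∀ n, 0 ≤ h n) (N : ℕ) :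
    ∑ n ∈ Finset.range N, h n ≤ 1 / (1 - κ) + 1 / (1 - η) := by
  have geo : ∀ {x : ℝ}, 0 < x → x < 1 → ∀ M, ∑ n ∈ Finset.range M, x ^ n ≤ 1 / (1 - x) := by
    intro x hx0 hx1 M
    rw [one_div, ← tsum_geometric_of_lt_one hx0.le hx1]
    exact (summable_geometric_of_lt_one hx0.le hx1).sum_le_tsum _ fun i _ => by positivity
  calc ∑ n ∈ Finset.range N, h n ≤ ∑ n ∈ Finset.range (k + 1 + N), h n :=
        Finset.sum_le_sum_of_subset_of_nonneg (Finset.range_mono (by omega)) fun i _ _ => h₀ i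
    _ = ∑ n ∈ Finset.range (k + 1), h n + ∑ n ∈ Finset.range N, h (k + 1 + n) :=
        Finset.sum_range_add _ _ _
    _ ≤ ∑ n ∈ Finset.range (k + 1), κ ^ (k - n) + ∑ n ∈ Finset.range N, η ^ n := by
        gcongr with n hn n hn
        · exact h₁ n (by simpa [Nat.lt_succ_iff] using hn)
        · exact h₂ n
    _ ≤ _ := by
        gcongr
        · rw [← Finset.sum_range_reflect]
          refine le_trans (le_of_eq ?_) (geo hκ₀ hκ₁ (k + 1))
          refine Finset.sum_congr rfl fun n hn => ?_
          congr 1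
          have := Finset.mem_range.1 hn
          omega
        · exact geo hη₀ hη₁ N

lemma pow_two_mul_eq_rpow {ρ γ q : ℝ} (hρ : 0 < ρ) (hq : ρ ^ γ = q) (n : ℕ) :
    q ^ (2 * n) = (ρ ^ n) ^ (2 * γ) := by
  rw [← hq, ← Real.rpow_natCast, ← Real.rpow_mul hρ.le, ← Real.rpow_natCast ρ n,
    ← Real.rpow_mul hρ.le]
  congr 1; push_cast; ring

/-- The sums of `q ^ (2 n) / (ε² + ρ ^ (2 n))` with `q = ρ ^ γ` are `O(ε ^ (2 γ - 2))`. -/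
lemma exists_sum_weighted_geometric_le {ρ γ q : ℝ} (hρ₀ : 0 < ρ) (hρ₁ : ρ < 1) (hγ₀ : 0 < γ)
    (hγ₁ : γ < 1) (hq : ρ ^ γ = q) :
    ∃ S : ℝ, 0 < S ∧ ∀ ε : ℝ, 0 < ε → ∀ N : ℕ,
      ∑ n ∈ Finset.range N, q ^ (2 * n) / (ε ^ 2 + ρ ^ (2 * n)) ≤ S * ε ^ (2 * γ - 2) := by
  have hq₀ : 0 < q := hq ▸ Real.rpow_pos_of_pos hρ₀ γ
  have hq₁ : q < 1 := hq ▸ Real.rpow_lt_one hρ₀.le hρ₁ hγ₀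
  have hρq : ρ < q := by
    rw [← hq]
    simpa using Real.rpow_lt_rpow_of_exponent_gt hρ₀ hρ₁ hγ₁
  have hqn := pow_two_mul_eq_rpow hρ₀ hq
  set κ := (ρ / q) ^ 2 with hκ
  have hκ₀ : 0 < κ := by positivity
  have hκ₁ : κ < 1 := pow_lt_one₀ (by positivity) ((div_lt_one hq₀).2 hρq) two_ne_zero
  have hη₁ : q ^ 2 < 1 := pow_lt_one₀ hq₀.le hq₁ two_ne_zero
  have hκ' : κ = ρ ^ (2 - 2 * γ) := by
    rw [hκ, ← hq, Real.rpow_sub hρ₀, div_pow, ← Real.rpow_natCast (ρ ^ γ), ← Real.rpow_mul hρ₀.le]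
    norm_num [mul_comm]
  refine ⟨1 / (1 - κ) + 1 / (1 - q ^ 2), by
    have := sub_pos.2 hκ₁; have := sub_pos.2 hη₁; positivity, fun ε hε N => ?_⟩
  rcases le_or_gt ε 1 with hε1 | hε1
  -- The crossover index: `ρ^(k+1) < ε ≤ ρ^k`. Up to `k` the summand `ρ²ⁿ` of the denominator is
  -- kept and gives the ratio `κ = ρ^(2 - 2γ)`; beyond `k` the summand `ε²` is kept and gives the
  -- ratio `q²`.
  · obtain ⟨k, hk1, hk2⟩ := exists_nat_pow_near_of_lt_one hε hε1 hρ₀ hρ₁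
    have key := sum_range_le_of_two_sided_geometric hκ₀ hκ₁ (pow_pos hq₀ 2) hη₁ k
      (h := fun n => q ^ (2 * n) / (ε ^ 2 + ρ ^ (2 * n)) * ε ^ (2 - 2 * γ)) ?_ ?_
      (fun n => by positivity) N
    · rw [← Finset.sum_mul] at key
      rwa [show 2 * γ - 2 = - (2 - 2 * γ) by ring, Real.rpow_neg hε.le, ← div_eq_mul_inv,
        le_div_iff₀ (by positivity)]
    · intro n hn
      have h1 : ρ ^ k = ρ ^ n * ρ ^ (k - n) := by rw [← pow_add]; congr 1; omega
      calc q ^ (2 * n) / (ε ^ 2 + ρ ^ (2 * n)) * ε ^ (2 - 2 * γ)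
          ≤ q ^ (2 * n) / ρ ^ (2 * n) * (ρ ^ k) ^ (2 - 2 * γ) := by
            gcongr
            · nlinarith
            · linarith
        _ = κ ^ (k - n) := by
            rw [h1, Real.mul_rpow (by positivity) (by positivity), ← Real.rpow_natCast ρ (k - n),
              ← Real.rpow_mul hρ₀.le, mul_comm ((k - n : ℕ) : ℝ), Real.rpow_mul hρ₀.le, ← hκ',
              Real.rpow_natCast, hqn, ← mul_assoc]
            convert one_mul _ using 2
            have e : ρ ^ (2 * n) = (ρ ^ n) ^ (2 : ℝ) := by
              rw [mul_comm 2 n, pow_mul]; norm_cast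
            rw [e, Real.rpow_sub (by positivity)]
            field_simp
    · intro n
      calc q ^ (2 * (k + 1 + n)) / (ε ^ 2 + ρ ^ (2 * (k + 1 + n))) * ε ^ (2 - 2 * γ)
          ≤ q ^ (2 * (k + 1 + n)) / ε ^ 2 * ε ^ (2 - 2 * γ) := by
            gcongr
            have : 0 < ρ ^ (2 * (k + 1 + n)) := by positivity
            linarith
        _ = (ρ ^ (k + 1)) ^ (2 * γ) * (q ^ 2) ^ n * (ε ^ (2 * γ))⁻¹ := by
            rw [← hqn, ← pow_mul, ← pow_add, Real.rpow_sub hε, ← mul_add]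
            norm_num
            field_simp
        _ ≤ ε ^ (2 * γ) * (q ^ 2) ^ n * (ε ^ (2 * γ))⁻¹ := by gcongr
        _ = (q ^ 2) ^ n := by field_simp
  -- For `ε > 1` there is no crossover: the denominator is at least `ε²`, and `ε^(-2) ≤ ε^(2γ - 2)`.
  · have geo : ∑ n ∈ Finset.range N, (q ^ 2) ^ n ≤ 1 / (1 - q ^ 2) := by
      rw [one_div, ← tsum_geometric_of_lt_one (by positivity) hη₁]
      exact (summable_geometric_of_lt_one (by positivity) hη₁).sum_le_tsum _
        fun i _ => by positivity
    calc ∑ n ∈ Finset.range N, q ^ (2 * n) / (ε ^ 2 + ρ ^ (2 * n))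
        ≤ ∑ n ∈ Finset.range N, (q ^ 2) ^ n * ε ^ (2 * γ - 2) := by
          refine Finset.sum_le_sum fun n _ => ?_
          rw [pow_mul, div_eq_mul_inv]
          gcongr
          calc (ε ^ 2 + ρ ^ (2 * n))⁻¹ ≤ (ε ^ 2)⁻¹ := by
                gcongr
                have : 0 < ρ ^ (2 * n) := by positivity
                linarith
            _ = ε ^ (-2 : ℝ) := by rw [Real.rpow_neg hε.le]; norm_cast
            _ ≤ _ := Real.rpow_le_rpow_of_exponent_le hε1.le (by linarith)
      _ ≤ _ := by
          rw [← Finset.sum_mul]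
          gcongr
          have := sub_pos.2 hκ₁
          have : 0 < 1 / (1 - κ) := by positivity
          linarith

/-- For `ε ≤ 1` one term with positive index of the weighted geometric series has the order of
`ε ^ (2 γ - 2)`. -/
lemma exists_weighted_geometric_ge {ρ γ q : ℝ} (hρ₀ : 0 < ρ) (hρ₁ : ρ < 1) (hγ₀ : 0 < γ)
    (hq : ρ ^ γ = q) {ε : ℝ} (hε : 0 < ε) (hε₁ : ε ≤ 1) :
    ∃ n : ℕ, q ^ 2 / 2 * ε ^ (2 * γ - 2) ≤ q ^ (2 * (n + 1)) / (ε ^ 2 + ρ ^ (2 * (n + 1))) := by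
  have hq₀ : 0 < q := hq ▸ Real.rpow_pos_of_pos hρ₀ γ
  obtain ⟨k, hk1, hk2⟩ := exists_nat_pow_near_of_lt_one hε hε₁ hρ₀ hρ₁
  -- The term of exponent `k + 1`, just past the crossover `ρ^(k+1) < ε ≤ ρ^k`: its denominator is
  -- at most `2 ε²`, and its numerator loses only a factor `q²` against `ε^(2γ)`.
  refine ⟨k, ?_⟩
  have h1 : ε ^ (2 * γ) ≤ q ^ (2 * k) := by
    calc ε ^ (2 * γ) ≤ (ρ ^ k) ^ (2 * γ) := by gcongr
      _ = _ := (pow_two_mul_eq_rpow hρ₀ hq k).symm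
  have h2 : ρ ^ (2 * (k + 1)) ≤ ε ^ 2 := by
    rw [mul_comm 2, pow_mul]; gcongr
  calc q ^ 2 / 2 * ε ^ (2 * γ - 2) = q ^ 2 * ε ^ (2 * γ) / (ε ^ 2 + ε ^ 2) := by
        rw [Real.rpow_sub hε]; norm_num; field_simp; ring
    _ ≤ q ^ 2 * q ^ (2 * k) / (ε ^ 2 + ρ ^ (2 * (k + 1))) := by gcongr
    _ = _ := by rw [← pow_add]; congr 2; ring

end GeometricSeries

/-! ### Rotation and half-angle substitution on circles. -/

section CircleIntegrals

lemma circleMap_add_angle (c : ℂ) (R t a : ℝ) :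
    circleMap c R (t + a) = c + Complex.exp (a * Complex.I) * circleMap 0 R t := by
  simp only [circleMap, zero_add]
  push_cast
  rw [add_mul, Complex.exp_add]
  ring

/-- Any two intervals of length `2π` are fundamental domains for the period of `circleMap`; in this
form no measurability of `F` is needed. -/
lemma setLIntegral_circleMap_add (c : ℂ) (R a b : ℝ) (F : ℂ → ℝ≥0∞) :
    ∫⁻ t in Ioc b (b + 2 * Real.pi), F (circleMap c R (t + a)) =
      ∫⁻ t in Ioc 0 (2 * Real.pi), F (circleMap c R t) := by
  have h1 : ∫⁻ t in Ioc b (b + 2 * Real.pi), F (circleMap c R (t + a)) =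
      ∫⁻ t in Ioc (b + a) (b + a + 2 * Real.pi), F (circleMap c R t) := by
    have := (measurePreserving_add_right volume a).setLIntegral_comp_preimage_emb
      (measurableEmbedding_addRight a) (fun t => F (circleMap c R t))
      (Ioc (b + a) (b + a + 2 * Real.pi))
    rw [← this]
    congr 2
    ext t
    simp only [mem_Ioc, mem_preimage]
    constructor <;> rintro ⟨h1, h2⟩ <;> constructor <;> linarith
  rw [h1]
  have h2 := (isAddFundamentalDomain_Ioc Real.two_pi_pos (b + a) volume).setLIntegral_eq
    (isAddFundamentalDomain_Ioc Real.two_pi_pos 0 volume) (fun t => F (circleMap c R t)) ?_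
  · rwa [zero_add] at h2
  · rintro ⟨g, hg⟩ t
    obtain ⟨n, rfl⟩ := AddSubgroup.mem_zmultiples_iff.1 hg
    congr 1
    change circleMap c R (n • (2 * Real.pi) + t) = _
    rw [add_comm]
    exact (periodic_circleMap c R).zsmul n t

lemma circleMap_two_mul_arctan (x : ℝ) :
    circleMap 0 1 (2 * Real.arctan x) = (1 + x * Complex.I) / (1 - x * Complex.I) := by
  have hx : (1 : ℂ) - x * Complex.I ≠ 0 := fun h => by
    have := congrArg Complex.re h
    simp at this
  have hc : 0 < Real.cos (Real.arctan x) := Real.cos_arctan_pos x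
  have hs : Real.sin (Real.arctan x) = x * Real.cos (Real.arctan x) := by
    rw [Real.sin_arctan, Real.cos_arctan]; ring
  have h2 := Real.cos_sq_arctan x
  rw [circleMap, eq_div_iff hx]
  simp only [Complex.ofReal_one, one_mul, zero_add]
  rw [Complex.exp_mul_I, ← Complex.ofReal_cos, ← Complex.ofReal_sin, Real.cos_two_mul,
    Real.sin_two_mul, hs]
  rw [eq_div_iff (by positivity)] at h2
  generalize Real.cos (Real.arctan x) = c at *
  apply Complex.ext
  · simp only [Complex.mul_re, Complex.add_re, Complex.sub_re, Complex.add_im, Complex.sub_im,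
      Complex.mul_im, Complex.ofReal_re, Complex.ofReal_im, Complex.I_re, Complex.I_im,
      Complex.one_re, Complex.one_im]
    linear_combination 2 * h2
  · simp only [Complex.mul_re, Complex.add_re, Complex.sub_re, Complex.add_im, Complex.sub_im,
      Complex.mul_im, Complex.ofReal_re, Complex.ofReal_im, Complex.I_re, Complex.I_im,
      Complex.one_re, Complex.one_im]
    ring

lemma image_two_mul_arctan_mul {κ : ℝ} (hκ : 0 < κ) :
    (fun x : ℝ => 2 * Real.arctan (κ * x)) '' univ = Ioo (-Real.pi) Real.pi := by
  ext t
  simp only [image_univ, mem_range, mem_Ioo]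
  constructor
  · rintro ⟨x, rfl⟩
    constructor
    · linarith [Real.neg_pi_div_two_lt_arctan (κ * x)]
    · linarith [Real.arctan_lt_pi_div_two (κ * x)]
  · rintro ⟨h1, h2⟩
    refine ⟨Real.tan (t / 2) / κ, ?_⟩
    rw [mul_div_cancel₀ _ hκ.ne', Real.arctan_tan (by linarith) (by linarith)]
    ring

/-- The half-angle substitution `t = 2 arctan (κ x)` in integrals over the unit circle. -/
lemma setLIntegral_circleMap_eq_lintegral {κ : ℝ} (hκ : 0 < κ) (F : ℂ → ℝ≥0∞) :
    ∫⁻ t in Ioc 0 (2 * Real.pi), F (circleMap 0 1 t) =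
      ∫⁻ x : ℝ, ENNReal.ofReal (2 * κ / (1 + (κ * x) ^ 2)) *
        F ((1 + (κ * x : ℝ) * Complex.I) / (1 - (κ * x : ℝ) * Complex.I)) := by
  have h1 := setLIntegral_circleMap_add 0 1 0 (-Real.pi) F
  simp only [add_zero] at h1
  rw [← h1, show -Real.pi + 2 * Real.pi = Real.pi by ring, ← setLIntegral_congr Ioo_ae_eq_Ioc,
    ← image_two_mul_arctan_mul hκ,
    lintegral_image_eq_lintegral_abs_deriv_mul (f' := fun x => 2 * κ / (1 + (κ * x) ^ 2))
      MeasurableSet.univ, setLIntegral_univ]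
  · refine lintegral_congr fun x => ?_
    rw [circleMap_two_mul_arctan, abs_of_pos (by positivity)]
  · intro x _
    refine HasDerivAt.hasDerivWithinAt ?_
    refine ((((hasDerivAt_id x).const_mul κ).arctan).const_mul 2).congr_deriv ?_
    simp only [id]
    ring
  · intro x _ y _ h
    simpa [hκ.ne'] using h

end CircleIntegrals

/-! ### Transport of the two norms by the Möbius map. -/

section MobiusIntegrals

variable {r : ℝ}

/-- The Möbius map carries the line integral with weight `1 / |x + z₀|²` to the unit circle. -/
lemma lintegral_comp_mobiusMap (hr₀ : 0 < r) (hr₁ : r < 1) (Φ : ℂ → ℝ≥0∞) :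
    ∫⁻ x : ℝ, ENNReal.ofReal (1 / ‖(x : ℂ) + basePoint r‖ ^ 2) * Φ (mobiusMap r x) =
      ENNReal.ofReal (1 / (2 * √(1 - r ^ 2))) *
        ∫⁻ t in Ioc 0 (2 * Real.pi), Φ (circleMap 0 1 t) := by
  have hs := sqrt_one_sub_sq_pos hr₀ hr₁
  -- A half turn is needed because `m(∞) = 1`, while the half-angle parametrization sends `∞` to
  -- `-1`. After it, `m` on the line is this parametrization with scale `κ = 1 / √(1 - r²)`.
  have h1 := setLIntegral_circleMap_add 0 1 Real.pi 0 Φ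
  rw [zero_add] at h1
  simp only [circleMap_add_angle, Complex.exp_pi_mul_I, zero_add, neg_one_mul] at h1
  rw [← h1, setLIntegral_circleMap_eq_lintegral (inv_pos.2 hs) (fun w => Φ (-w)),
    ← lintegral_const_mul' _ _ ENNReal.ofReal_ne_top]
  refine lintegral_congr fun x => ?_
  rw [← mul_assoc, ← ENNReal.ofReal_mul (by positivity), normSq_add_basePoint]
  congr 2
  · simp; field_simp; ring
  · have h2 : (x : ℂ) + basePoint r ≠ 0 := add_basePoint_ne_zero hr₀ hr₁ (by simp)
    have hs' : ((√(1 - r ^ 2) : ℝ) : ℂ) ≠ 0 := by exact_mod_cast hs.ne'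
    have h3 : (1 : ℂ) - ((√(1 - r ^ 2))⁻¹ * x : ℝ) * Complex.I =
        -Complex.I / √(1 - r ^ 2) * (x + basePoint r) := by
      rw [basePoint]; push_cast; field_simp; linear_combination (√(1 - r ^ 2) : ℂ) * Complex.I_sq
    have h4 : (1 : ℂ) + ((√(1 - r ^ 2))⁻¹ * x : ℝ) * Complex.I =
        Complex.I / √(1 - r ^ 2) * (x - basePoint r) := by
      rw [basePoint]; push_cast; field_simp; linear_combination (√(1 - r ^ 2) : ℂ) * Complex.I_sq
    rw [h3, h4, mobiusMap]
    have := Complex.I_ne_zero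
    field_simp

/-- The Möbius map carries the integral over `Γ` with weight `1 / |ζ + z₀|²` to the circle of
radius `ρ`. -/
lemma setLIntegral_comp_mobiusMap (hr₀ : 0 < r) (hr₁ : r < 1) (Φ : ℂ → ℝ≥0∞) :
    ∫⁻ t in Ioc 0 (2 * Real.pi),
        ENNReal.ofReal (1 / ‖circleMap Complex.I r t + basePoint r‖ ^ 2) *
          Φ (mobiusMap r (circleMap Complex.I r t)) =
      ENNReal.ofReal (1 / (2 * √(1 - r ^ 2) * (1 + √(1 - r ^ 2)))) *
        ∫⁻ t in Ioc 0 (2 * Real.pi), Φ (circleMap 0 (rhoRadius r) t) := by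
  have hs := sqrt_one_sub_sq_pos hr₀ hr₁
  have hρ₀ := rhoRadius_pos hr₀ hr₁
  have hρ₁ := rhoRadius_lt_one hr₀ hr₁
  have hκ : 0 < (1 - rhoRadius r) / (1 + rhoRadius r) := div_pos (by linarith) (by linarith)
  -- The quarter turn puts angle `0` of `Γ` on the imaginary axis, which `m` maps to the real axis.
  -- In half-angle coordinates `m : Γ → {|w| = ρ}` then becomes the dilation `x ↦ κ x` with `κ = (1
  -- - ρ) / (1 + ρ)`.
  have h1 := setLIntegral_circleMap_add Complex.I r (Real.pi / 2) 0 fun ζ =>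
    ENNReal.ofReal (1 / ‖ζ + basePoint r‖ ^ 2) * Φ (mobiusMap r ζ)
  have e1 : Complex.exp ((Real.pi / 2 : ℝ) * Complex.I) = Complex.I := by
    push_cast; exact Complex.exp_pi_div_two_mul_I
  have e2 : ∀ R t : ℝ, circleMap 0 R t = R * circleMap 0 1 t := fun R t => by simp [circleMap]
  simp only [circleMap_add_angle, e1, zero_add] at h1
  rw [← h1]
  simp only [e2 r, e2 (rhoRadius r)]
  rw [setLIntegral_circleMap_eq_lintegral one_pos fun w =>
      ENNReal.ofReal (1 / ‖Complex.I + Complex.I * (r * w) + basePoint r‖ ^ 2) *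
        Φ (mobiusMap r (Complex.I + Complex.I * (r * w))),
    setLIntegral_circleMap_eq_lintegral hκ fun w => Φ (rhoRadius r * w),
    ← lintegral_const_mul' _ _ ENNReal.ofReal_ne_top]
  refine lintegral_congr fun x => ?_
  have hne : ∀ y : ℝ, (1 : ℂ) - Complex.I * y ≠ 0 := fun y h => by
    have := congrArg Complex.re h
    simp at this
  have hx' := hne x
  have hx : (1 : ℂ) - x * Complex.I ≠ 0 := by rwa [mul_comm]
  have hρs := rhoRadius_mul_one_add_sqrt hr₀ hr₁
  have hρr := rhoRadius_mul hr₀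
  have hρs2 := rhoRadius_sq_mul hr₀ hr₁
  simp only [one_mul, mul_one]
  rw [← mul_assoc (ENNReal.ofReal _), ← mul_assoc (ENNReal.ofReal _),
    ← ENNReal.ofReal_mul (by positivity),
    ← ENNReal.ofReal_mul (by positivity), mobiusMap]
  rw [basePoint]
  generalize √(1 - r ^ 2) = s at *
  generalize rhoRadius r = ρ at *
  have hρsC : (ρ : ℂ) * (1 + s) = r := by exact_mod_cast hρs
  have hρrC : (ρ : ℂ) * r = 1 - s := by exact_mod_cast hρr
  have h1s : (1 : ℂ) + s ≠ 0 := by exact_mod_cast (by positivity : (1 + s : ℝ) ≠ 0)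
  have h1ρ : (1 : ℂ) + ρ ≠ 0 := by exact_mod_cast (by positivity : (1 + ρ : ℝ) ≠ 0)
  set κ := (1 - ρ) / (1 + ρ) with hκd
  have hκ1 : (1 + ρ) * κ = 1 - ρ := by rw [hκd]; field_simp
  have hκC : (1 + ρ : ℂ) * κ = 1 - ρ := by exact_mod_cast hκ1
  have hD : Complex.I + Complex.I * (r * ((1 + x * Complex.I) / (1 - x * Complex.I))) +
      Complex.I * s = Complex.I * ((1 + s) * (1 + ρ)) * (1 - (κ * x : ℝ) * Complex.I) /
        (1 - x * Complex.I) := by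
    rw [eq_div_iff hx]
    push_cast
    field_simp
    linear_combination - (1 + x * Complex.I) * hρsC + (1 + s) * x * Complex.I * hκC
  have hN : Complex.I + Complex.I * (r * ((1 + x * Complex.I) / (1 - x * Complex.I))) -
      Complex.I * s = Complex.I * (r * (1 + ρ)) * (1 + (κ * x : ℝ) * Complex.I) /
        (1 - x * Complex.I) := by
    rw [eq_div_iff hx]
    push_cast
    field_simp
    linear_combination - (1 - x * Complex.I) * hρrC - r * x * Complex.I * hκC
  have hn : ∀ y : ℝ, ‖(1 : ℂ) - y * Complex.I‖ ^ 2 = 1 + y ^ 2 := fun y => by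
    rw [← Complex.normSq_eq_norm_sq, Complex.normSq_apply]; simp; ring
  congr 2
  · rw [hD, norm_div, norm_mul, norm_mul, div_pow, mul_pow, hn, hn, mul_pow]
    norm_cast
    rw [Complex.norm_I, Real.norm_of_nonneg (by positivity)]
    have hρs3 : (1 - ρ) * (1 + ρ) * (1 + s) = 2 * s := by linear_combination - hρs2
    have h1ρ' : 0 < 1 - ρ := by linarith
    rw [← hρs3, hκd]
    field_simp
  · rw [hD, hN]
    have := Complex.I_ne_zero
    have h3 := hne (κ * x)
    rw [← hρsC]
    field_simp

end MobiusIntegrals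

/-! ### Parseval's identity for power series. -/

section Parseval

lemma integral_sq_norm_sum_circleMap (b : ℕ → ℂ) (R : ℝ) (N : ℕ) :
    ∫ t in (0 : ℝ)..2 * Real.pi, ‖∑ n ∈ Finset.range N, b n * circleMap 0 R t ^ n‖ ^ 2 =
      2 * Real.pi * ∑ n ∈ Finset.range N, ‖b n‖ ^ 2 * R ^ (2 * n) := by
  set p : Polynomial ℂ := ∑ n ∈ Finset.range N, Polynomial.monomial n (b n * R ^ n) with hp
  have hc : ∀ n, p.coeff n = if n < N then b n * R ^ n else 0 := fun n => by
    simp [hp, Polynomial.coeff_monomial]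
  have h1 := p.sum_sq_norm_coeff_eq_circleAverage
  rw [Real.circleAverage_def, smul_eq_mul, eq_inv_mul_iff_mul_eq₀ (by positivity)] at h1
  have h2 : ∑ i ∈ p.support, ‖p.coeff i‖ ^ 2 =
      ∑ n ∈ Finset.range N, ‖b n‖ ^ 2 * R ^ (2 * n) := by
    rw [Finset.sum_subset (s₂ := Finset.range N)]
    · refine Finset.sum_congr rfl fun n hn => ?_
      rw [hc, if_pos (Finset.mem_range.1 hn), norm_mul, norm_pow, mul_pow, ← pow_mul,
        mul_comm n 2, pow_mul, pow_mul]
      simp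
    · intro n hn
      rw [Polynomial.mem_support_iff, hc] at hn
      simpa using fun h : N ≤ n => hn (if_neg (by omega))
    · intro n _ hn
      simp [Polynomial.notMem_support_iff.1 hn]
  rw [← h2, h1]
  refine intervalIntegral.integral_congr fun t _ => ?_
  simp only [hp, Polynomial.eval_finsetSum, Polynomial.eval_monomial]
  congr 2
  refine Finset.sum_congr rfl fun n _ => ?_
  simp [circleMap, mul_pow, mul_assoc]

/-- **Parseval's identity** on a circle for an absolutely convergent power series. -/
lemma lintegral_sq_norm_circleMap {b : ℕ → ℂ} {R : ℝ} (hR : 0 ≤ R)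
    (hb : Summable fun n => ‖b n‖ * R ^ n) {G : ℂ → ℂ}
    (hG : ∀ w, ‖w‖ = R → HasSum (fun n => b n * w ^ n) (G w)) :
    HasSum (fun n => ‖b n‖ ^ 2 * R ^ (2 * n))
      ((∫⁻ t in Ioc 0 (2 * Real.pi), ‖G (circleMap 0 R t)‖ₑ ^ 2).toReal / (2 * Real.pi)) ∧
    ∫⁻ t in Ioc 0 (2 * Real.pi), ‖G (circleMap 0 R t)‖ₑ ^ 2 < ∞ := by
  set B := ∑' n, ‖b n‖ * R ^ n
  have hw : ∀ t, ‖circleMap 0 R t‖ = R := fun t => by simp [abs_of_nonneg hR]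
  have hpart : ∀ N t, ‖∑ n ∈ Finset.range N, b n * circleMap 0 R t ^ n‖ ≤ B := fun N t => by
    refine (norm_sum_le _ _).trans ?_
    simp only [norm_mul, norm_pow, hw]
    exact hb.sum_le_tsum _ fun i _ => by positivity
  have hlim : ∀ t, Tendsto (fun N => ∑ n ∈ Finset.range N, b n * circleMap 0 R t ^ n) atTop
      (𝓝 (G (circleMap 0 R t))) := fun t => (hG _ (hw t)).tendsto_sum_nat
  have hmeas : Measurable fun t => G (circleMap 0 R t) :=
    measurable_of_tendsto_metrizable (fun N => by fun_prop) (tendsto_pi_nhds.2 hlim)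
  have hGB : ∀ t, ‖G (circleMap 0 R t)‖ ≤ B := fun t =>
    le_of_tendsto (hlim t).norm (Eventually.of_forall fun N => hpart N t)
  have hB : 0 ≤ B := (norm_nonneg _).trans (hGB 0)
  have hint : IntegrableOn (fun t => ‖G (circleMap 0 R t)‖ ^ 2) (Ioc 0 (2 * Real.pi)) := by
    refine Measure.integrableOn_of_bounded (M := B ^ 2) measure_Ioc_lt_top.ne
      (hmeas.norm.pow_const 2).aestronglyMeasurable (Eventually.of_forall fun t => ?_)
    rw [norm_pow, norm_norm]
    gcongr
    exact hGB t
  have hconv : Tendsto (fun N => ∫ t in (0 : ℝ)..2 * Real.pi,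
      ‖∑ n ∈ Finset.range N, b n * circleMap 0 R t ^ n‖ ^ 2) atTop
      (𝓝 (∫ t in (0 : ℝ)..2 * Real.pi, ‖G (circleMap 0 R t)‖ ^ 2)) := by
    refine intervalIntegral.tendsto_integral_filter_of_dominated_convergence (fun _ => B ^ 2)
      (Eventually.of_forall fun N => by fun_prop)
      (Eventually.of_forall fun N => Eventually.of_forall fun t _ => ?_) (by simp)
      (Eventually.of_forall fun t _ => ((hlim t).norm.pow 2))
    rw [norm_pow, norm_norm]
    gcongr
    exact hpart N t
  have henn : ∫⁻ t in Ioc 0 (2 * Real.pi), ‖G (circleMap 0 R t)‖ₑ ^ 2 =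
      ENNReal.ofReal (∫ t in (0 : ℝ)..2 * Real.pi, ‖G (circleMap 0 R t)‖ ^ 2) := by
    rw [intervalIntegral.integral_of_le Real.two_pi_pos.le, ofReal_integral_eq_lintegral_ofReal hint
      (Eventually.of_forall fun t => by positivity)]
    refine lintegral_congr fun t => ?_
    rw [ENNReal.ofReal_pow (norm_nonneg _), ofReal_norm]
  refine ⟨?_, henn ▸ ENNReal.ofReal_lt_top⟩
  rw [henn, ENNReal.toReal_ofReal
    (intervalIntegral.integral_nonneg Real.two_pi_pos.le fun t _ => by positivity),
    hasSum_iff_tendsto_nat_of_nonneg fun n => by positivity]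
  have h3 := hconv.div_const (2 * Real.pi)
  simp only [integral_sq_norm_sum_circleMap] at h3
  refine h3.congr fun N => ?_
  field_simp

end Parseval

/-! ### The norms as integrals of squares. -/

section Norms

lemma eLpNorm_two_le_ofReal_iff {α : Type*} [MeasurableSpace α] {μ : Measure α} {f : α → ℂ}
    {A : ℝ} (hA : 0 ≤ A) :
    eLpNorm f 2 μ ≤ ENNReal.ofReal A ↔ ∫⁻ x, ‖f x‖ₑ ^ 2 ∂μ ≤ ENNReal.ofReal (A ^ 2) := by
  rw [eLpNorm_eq_lintegral_rpow_enorm_toReal two_ne_zero ENNReal.ofNat_ne_top,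
    ENNReal.ofReal_pow hA, ENNReal.toReal_ofNat, one_div, ENNReal.rpow_inv_le_iff two_pos]
  norm_cast

lemma hardyNorm_le_ofReal_iff {f : ℂ → ℂ} {A : ℝ} (hA : 0 ≤ A) :
    hardyNorm f ≤ ENNReal.ofReal A ↔ ∀ y : ℝ, 0 < y →
      ∫⁻ x : ℝ, ‖f ((x : ℂ) + (y : ℂ) * Complex.I)‖ₑ ^ 2 ≤ ENNReal.ofReal (A ^ 2) := by
  simp only [hardyNorm, iSup_le_iff, eLpNorm_two_le_ofReal_iff hA]

lemma circleL2Norm_le_ofReal_iff {c : ℂ} {r : ℝ} {f : ℂ → ℂ} {A : ℝ} (hA : 0 ≤ A) :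
    circleL2Norm c r f ≤ ENNReal.ofReal A ↔
      ENNReal.ofReal r * ∫⁻ t in Ioc 0 (2 * Real.pi), ‖f (circleMap c r t)‖ₑ ^ 2 ≤
        ENNReal.ofReal (A ^ 2) := by
  rw [circleL2Norm, eLpNorm_two_le_ofReal_iff hA, lintegral_smul_measure, smul_eq_mul]

lemma enorm_div_sq (a b : ℂ) (hb : b ≠ 0) :
    ‖a / b‖ₑ ^ 2 = ENNReal.ofReal (1 / ‖b‖ ^ 2) * ‖a‖ₑ ^ 2 := by
  rw [← ofReal_norm, ← ofReal_norm, ← ENNReal.ofReal_pow (norm_nonneg _),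
    ← ENNReal.ofReal_pow (norm_nonneg _), ← ENNReal.ofReal_mul (by positivity), norm_div]
  congr 1
  ring

end Norms

/-! ### Poisson means and comparison with the boundary. -/

section MeanValue

lemma enorm_le_circle_lintegral {H : ℂ → ℂ} {c : ℂ} {R : ℝ}
    (hH : DiffContOnCl ℂ H (Metric.ball c |R|)) :
    ‖H c‖ₑ ≤ ENNReal.ofReal (1 / (2 * Real.pi)) *
      ∫⁻ t in Ioc 0 (2 * Real.pi), ‖H (circleMap c R t)‖ₑ := by
  rw [← hH.circleAverage, Real.circleAverage_def, enorm_smul,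
    intervalIntegral.integral_of_le Real.two_pi_pos.le, one_div,
    Real.enorm_eq_ofReal (by positivity)]
  gcongr
  exact enorm_integral_le_lintegral_enorm _

variable {r : ℝ}

/-- For a function of the form `G (m ζ) / (ζ + z₀)` with `G` analytic on a neighbourhood of the
closed disc, the values on a horizontal line are dominated by Poisson means of the boundary
values. -/
lemma enorm_sq_le_lintegral_line (hr₀ : 0 < r) (hr₁ : r < 1) {G : ℂ → ℂ} {R : ℝ} (hR : 1 < R)
    (hG : DifferentiableOn ℂ G (Metric.ball 0 R)) (x : ℝ) {y : ℝ} (hy : 0 < y) :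
    ‖G (mobiusMap r (x + y * Complex.I)) / (x + y * Complex.I + basePoint r)‖ₑ ^ 2 ≤
      ENNReal.ofReal (1 / (2 * Real.pi)) * ∫⁻ u : ℝ, ENNReal.ofReal (2 / (1 + u ^ 2)) *
        ‖G (mobiusMap r ((x + y * u : ℝ) : ℂ)) / ((x + y * u : ℝ) + basePoint r)‖ₑ ^ 2 := by
  have hs := sqrt_one_sub_sq_pos hr₀ hr₁
  -- The map `ζ(w) = x + i y (1 - w) / (1 + w)` takes the disc to the half-plane and `0` to `x + i
  -- y`. Here `D` and `N` are `(1 + w)(ζ(w) ± z₀)`, and `H` is the square of the function along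
  -- `ζ(w)`. Clearing `1 + w` keeps `H` analytic at `w = -1`, where `ζ(w) = ∞`, so the mean value
  -- property at `0` applies.
  set D : ℂ → ℂ := fun w => x * (1 + w) + y * Complex.I * (1 - w) + basePoint r * (1 + w) with hD
  set N : ℂ → ℂ := fun w => x * (1 + w) + y * Complex.I * (1 - w) - basePoint r * (1 + w) with hN
  set H : ℂ → ℂ := fun w => (G (N w / D w) * (1 + w) / D w) ^ 2 with hH
  have hDN : ∀ w : ℂ, ‖D w‖ ^ 2 - ‖N w‖ ^ 2 = 4 * √(1 - r ^ 2) * y * (1 - ‖w‖ ^ 2) := fun w => by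
    simp only [← Complex.normSq_eq_norm_sq, Complex.normSq_apply, hD, hN]
    simp
    ring
  have hD0 : ∀ w : ℂ, ‖w‖ ≤ 1 → D w ≠ 0 := fun w hw h => by
    -- A zero of `D` with `|w| ≤ 1` would put `x + i y` no farther from `-z₀` than its conjugate,
    -- which is impossible for `y > 0`.
    have h1 : (x + y * Complex.I + basePoint r) = -w * (x - y * Complex.I + basePoint r) := by
      simp only [hD] at h
      linear_combination h
    have h2 : ‖x + y * Complex.I + basePoint r‖ ≤ ‖(x : ℂ) - y * Complex.I + basePoint r‖ := by
      rw [h1, norm_mul, norm_neg]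
      exact mul_le_of_le_one_left (norm_nonneg _) hw
    rw [← pow_le_pow_iff_left₀ (norm_nonneg _) (norm_nonneg _) two_ne_zero,
      normSq_add_basePoint, normSq_add_basePoint] at h2
    simp at h2
    nlinarith
  have hND : ∀ w : ℂ, ‖w‖ ≤ 1 → ‖N w / D w‖ ≤ 1 := fun w hw => by
    rw [norm_div, div_le_one (norm_pos_iff.2 (hD0 w hw)),
      ← pow_le_pow_iff_left₀ (norm_nonneg _) (norm_nonneg _) two_ne_zero, ← sub_nonneg, hDN]
    have : 0 ≤ 1 - ‖w‖ ^ 2 := by nlinarith [norm_nonneg w]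
    positivity
  have hHd : DiffContOnCl ℂ H (Metric.ball 0 |1|) := by
    refine DifferentiableOn.diffContOnCl fun w hw => ?_
    rw [abs_one, closure_ball _ one_ne_zero, mem_closedBall_zero_iff] at hw
    have hGw : DifferentiableAt ℂ G (N w / D w) :=
      hG.differentiableAt (Metric.isOpen_ball.mem_nhds (by simpa using (hND w hw).trans_lt hR))
    have hNd : DifferentiableAt ℂ N w := by fun_prop
    have hDd : DifferentiableAt ℂ D w := by fun_prop
    have hGc : DifferentiableAt ℂ (fun w => G (N w / D w)) w :=
      hGw.comp w (hNd.fun_div hDd (hD0 w hw))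
    exact ((hGc.fun_mul (by fun_prop)).fun_div hDd
      (hD0 w hw)).fun_pow 2 |>.differentiableWithinAt
  have key := enorm_le_circle_lintegral hHd
  rw [setLIntegral_circleMap_eq_lintegral one_pos fun w => ‖H w‖ₑ] at key
  have hH0 : H 0 = (G (mobiusMap r (x + y * Complex.I)) /
      (x + y * Complex.I + basePoint r)) ^ 2 := by
    simp [hH, hD, hN, mobiusMap]
  rw [hH0, enorm_pow] at key
  refine key.trans_eq ?_
  congr 1
  refine lintegral_congr fun u => ?_
  simp only [one_mul, mul_one]
  congr 1
  have hu : (1 : ℂ) - u * Complex.I ≠ 0 := fun h => by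
    have := congrArg Complex.re h
    simp at this
  have h1 : 1 + (1 + u * Complex.I) / (1 - u * Complex.I) = 2 / (1 - u * Complex.I) := by
    rw [eq_div_iff hu, add_mul, div_mul_cancel₀ _ hu]; ring
  have h2 : 1 - (1 + u * Complex.I) / (1 - u * Complex.I) =
      -2 * u * Complex.I / (1 - u * Complex.I) := by
    rw [eq_div_iff hu, sub_mul, div_mul_cancel₀ _ hu]; ring
  have h3 : ((x + y * u : ℝ) : ℂ) + basePoint r ≠ 0 := add_basePoint_ne_zero hr₀ hr₁ (by simp)
  have hDu : D ((1 + u * Complex.I) / (1 - u * Complex.I)) =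
      ((x + y * u : ℝ) + basePoint r) * (2 / (1 - u * Complex.I)) := by
    simp only [hD, h1, h2]
    push_cast
    linear_combination (-2 * y * u / (1 - u * Complex.I)) * Complex.I_sq
  have hNu : N ((1 + u * Complex.I) / (1 - u * Complex.I)) =
      ((x + y * u : ℝ) - basePoint r) * (2 / (1 - u * Complex.I)) := by
    simp only [hN, h1, h2]
    push_cast
    linear_combination (-2 * y * u / (1 - u * Complex.I)) * Complex.I_sq
  have h4 : 2 / (1 - u * Complex.I) ≠ 0 := div_ne_zero two_ne_zero hu
  simp only [hH]
  rw [enorm_pow, hDu, hNu, h1, mul_div_mul_right _ _ h4, mul_div_mul_right _ _ h4, mobiusMap]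

lemma lintegral_two_div_one_add_sq :
    ∫⁻ u : ℝ, ENNReal.ofReal (2 / (1 + u ^ 2)) = ENNReal.ofReal (2 * Real.pi) := by
  have := setLIntegral_circleMap_eq_lintegral one_pos fun _ => 1
  simpa using this.symm

/-- The `L²`-norm on a horizontal line is at most the `L²`-norm of the boundary values. -/
lemma lintegral_line_le (hr₀ : 0 < r) (hr₁ : r < 1) {G : ℂ → ℂ} {R : ℝ} (hR : 1 < R)
    (hG : DifferentiableOn ℂ G (Metric.ball 0 R)) {y : ℝ} (hy : 0 < y) :
    ∫⁻ x : ℝ, ‖G (mobiusMap r (x + y * Complex.I)) / (x + y * Complex.I + basePoint r)‖ₑ ^ 2 ≤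
      ∫⁻ x : ℝ, ‖G (mobiusMap r x) / (x + basePoint r)‖ₑ ^ 2 := by
  set F : ℝ → ℝ≥0∞ := fun x => ‖G (mobiusMap r x) / (x + basePoint r)‖ₑ ^ 2 with hF
  have hne : ∀ x : ℝ, (x : ℂ) + basePoint r ≠ 0 := fun x =>
    add_basePoint_ne_zero hr₀ hr₁ (by simp)
  have hFm : Measurable F := by
    refine (Continuous.measurable ?_).enorm.pow_const 2
    refine Continuous.div ?_ (by fun_prop) hne
    refine hG.continuousOn.comp_continuous ?_ fun x => ?_
    · unfold mobiusMap
      exact Continuous.div (by fun_prop) (by fun_prop) hne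
    · rw [mem_ball_zero_iff, mobiusMap, norm_div]
      refine lt_of_le_of_lt (div_le_one_of_le₀ ?_ (norm_nonneg _)) hR
      rw [← pow_le_pow_iff_left₀ (norm_nonneg _) (norm_nonneg _) two_ne_zero,
        normSq_add_basePoint, normSq_sub_basePoint]
      simp
  calc _ ≤ ∫⁻ x : ℝ, ENNReal.ofReal (1 / (2 * Real.pi)) *
        ∫⁻ u : ℝ, ENNReal.ofReal (2 / (1 + u ^ 2)) * F (x + y * u) :=
        lintegral_mono fun x => enorm_sq_le_lintegral_line hr₀ hr₁ hR hG x hy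
    _ = ENNReal.ofReal (1 / (2 * Real.pi)) *
        ∫⁻ u : ℝ, ENNReal.ofReal (2 / (1 + u ^ 2)) * ∫⁻ x : ℝ, F (x + y * u) := by
        rw [lintegral_const_mul' _ _ ENNReal.ofReal_ne_top, lintegral_lintegral_swap]
        · congr 1
          refine lintegral_congr fun u => ?_
          rw [lintegral_const_mul' _ _ ENNReal.ofReal_ne_top]
        · refine Measurable.aemeasurable (Measurable.mul (by fun_prop)
            (hFm.comp (f := fun p : ℝ × ℝ => p.1 + y * p.2) (by fun_prop)))
    _ = ∫⁻ x : ℝ, F x := by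
        -- After Fubini, translation invariance removes `y u`, and the Cauchy density has total mass
        -- one.
        simp only [lintegral_add_right_eq_self]
        rw [lintegral_mul_const _ (by fun_prop), lintegral_two_div_one_add_sq, ← mul_assoc,
          ← ENNReal.ofReal_mul (by positivity), one_div_mul_cancel (by positivity)]
        simp

end MeanValue

/-! ### The extremal function. -/

section Extremal

variable {r : ℝ} {z : ℂ} {ε : ℝ}

/-- The coefficients of the power series in `m(ζ)` of the extremal function. -/
def extremalCoeff (r : ℝ) (z : ℂ) (ε : ℝ) (n : ℕ) : ℂ :=
  if n = 0 then 0 else ((ε ^ (2 - gammaExponent r z) : ℝ) : ℂ) *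
    (conj (mobiusMap r z) ^ n / ((ε ^ 2 + rhoRadius r ^ (2 * n) : ℝ) : ℂ))

/-- The power series such that `M(ζ) = G(m(ζ)) / (ζ + z₀)`. -/
def extremalPowerSeries (r : ℝ) (z : ℂ) (ε : ℝ) (w : ℂ) : ℂ := ∑' n, extremalCoeff r z ε n * w ^ n

lemma extremalCoeff_succ_mul (ζ : ℂ) (n : ℕ) :
    extremalCoeff r z ε (n + 1) * mobiusMap r ζ ^ (n + 1) =
      ((ε ^ (2 - gammaExponent r z) : ℝ) : ℂ) * extremalTerm r z ε ζ (n + 1) := by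
  rw [extremalCoeff, if_neg n.succ_ne_zero, extremalTerm, mul_pow]
  ring

lemma norm_extremalCoeff_le (hr₀ : 0 < r) (hr₁ : r < 1) (hε : 0 < ε) (n : ℕ) :
    ‖extremalCoeff r z ε n‖ ≤ ε ^ (2 - gammaExponent r z) *
      (‖mobiusMap r z‖ ^ n / (ε ^ 2 + rhoRadius r ^ (2 * n))) := by
  have hρ := rhoRadius_pos hr₀ hr₁
  rw [extremalCoeff]
  split_ifs
  · rw [norm_zero]; positivity
  · rw [norm_mul, norm_div, norm_pow, Complex.norm_real, Complex.norm_real, Complex.norm_conj,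
      Real.norm_of_nonneg (by positivity), Real.norm_of_nonneg (by positivity)]

lemma summable_extremalCoeff_mul_pow (hr₀ : 0 < r) (hr₁ : r < 1) (hε : 0 < ε) {R : ℝ} (hR : 0 ≤ R)
    (h : ‖mobiusMap r z‖ * R < 1) : Summable fun n => ‖extremalCoeff r z ε n‖ * R ^ n := by
  have hρ := rhoRadius_pos hr₀ hr₁
  refine Summable.of_nonneg_of_le (fun n => by positivity) (fun n => ?_)
    ((summable_geometric_of_lt_one (by positivity) h).mul_left
      (ε ^ (2 - gammaExponent r z) / ε ^ 2))
  calc ‖extremalCoeff r z ε n‖ * R ^ n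
      ≤ ε ^ (2 - gammaExponent r z) * (‖mobiusMap r z‖ ^ n / ε ^ 2) * R ^ n := by
        gcongr
        refine (norm_extremalCoeff_le hr₀ hr₁ hε n).trans ?_
        gcongr
        have : 0 < rhoRadius r ^ (2 * n) := by positivity
        linarith
    _ = _ := by rw [mul_pow]; ring

lemma hasSum_extremalPowerSeries (hr₀ : 0 < r) (hr₁ : r < 1) (hε : 0 < ε) {w : ℂ}
    (h : ‖mobiusMap r z‖ * ‖w‖ < 1) :
    HasSum (fun n => extremalCoeff r z ε n * w ^ n) (extremalPowerSeries r z ε w) := by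
  refine (Summable.of_norm ?_).hasSum
  simpa using summable_extremalCoeff_mul_pow hr₀ hr₁ hε (norm_nonneg w) h

lemma differentiableOn_extremalPowerSeries (hr₀ : 0 < r) (hr₁ : r < 1) (hε : 0 < ε) {R : ℝ}
    (hR : 0 ≤ R) (h : ‖mobiusMap r z‖ * R < 1) :
    DifferentiableOn ℂ (extremalPowerSeries r z ε) (Metric.ball 0 R) := by
  refine Complex.differentiableOn_tsum_of_summable_norm (summable_extremalCoeff_mul_pow hr₀ hr₁ hε hR h)
    (fun n => by fun_prop) Metric.isOpen_ball fun n w hw => ?_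
  rw [norm_mul, norm_pow]
  gcongr
  exact (mem_ball_zero_iff.1 hw).le

lemma summable_extremalTerm (hr₀ : 0 < r) (hr₁ : r < 1) (hz : 0 < z.im) (hε : 0 < ε) {ζ : ℂ}
    (hζ : 0 < ζ.im) : Summable fun n : ℕ => extremalTerm r z ε ζ (n + 1) := by
  have h1 := (norm_mobiusMap_lt_one_iff hr₀ hr₁ (add_basePoint_ne_zero hr₀ hr₁ hz.le)).2 hz
  have h2 := (norm_mobiusMap_lt_one_iff hr₀ hr₁ (add_basePoint_ne_zero hr₀ hr₁ hζ.le)).2 hζ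
  have h3 := (summable_nat_add_iff 1).2 (hasSum_extremalPowerSeries (ε := ε) hr₀ hr₁ hε
    (mul_lt_one_of_nonneg_of_lt_one_left (norm_nonneg _) h1 h2.le)).summable
  simp only [extremalCoeff_succ_mul] at h3
  refine (summable_mul_left_iff ?_).1 h3
  exact_mod_cast (Real.rpow_pos_of_pos hε _).ne'

lemma extremalFunction_eq (hr₀ : 0 < r) (hr₁ : r < 1) (hε : 0 < ε) {ζ : ℂ}
    (h : ‖mobiusMap r z‖ * ‖mobiusMap r ζ‖ < 1) :
    extremalFunction r z ε ζ =
      extremalPowerSeries r z ε (mobiusMap r ζ) / (ζ + basePoint r) := by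
  rw [extremalFunction, extremalPowerSeries,
    (hasSum_extremalPowerSeries hr₀ hr₁ hε h).summable.tsum_eq_zero_add]
  simp only [extremalCoeff_succ_mul, tsum_mul_left]
  simp [extremalCoeff]
  ring

/-- The coefficients are proportional to `conj(m(z))ⁿ / (ε² + ρ²ⁿ)`, so one factor of the
denominator cancels against the weight and leaves the summand of the geometric estimate. -/
lemma sq_norm_extremalCoeff_le (hr₀ : 0 < r) (hr₁ : r < 1) (hε : 0 < ε) (n : ℕ) :
    ‖extremalCoeff r z ε n‖ ^ 2 * (ε ^ 2 + rhoRadius r ^ (2 * n)) ≤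
      ε ^ (4 - 2 * gammaExponent r z) *
        (‖mobiusMap r z‖ ^ (2 * n) / (ε ^ 2 + rhoRadius r ^ (2 * n))) := by
  have hρ := rhoRadius_pos hr₀ hr₁
  have h : ε ^ (4 - 2 * gammaExponent r z) = (ε ^ (2 - gammaExponent r z)) ^ 2 := by
    rw [← Real.rpow_natCast, ← Real.rpow_mul hε.le]
    congr 1; push_cast; ring
  calc _ ≤ (ε ^ (2 - gammaExponent r z) *
      (‖mobiusMap r z‖ ^ n / (ε ^ 2 + rhoRadius r ^ (2 * n)))) ^ 2 *
        (ε ^ 2 + rhoRadius r ^ (2 * n)) := by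
        gcongr
        exact norm_extremalCoeff_le hr₀ hr₁ hε n
    _ = _ := by
        have : 0 < ε ^ 2 + rhoRadius r ^ (2 * n) := by positivity
        rw [h, mul_pow, div_pow, mul_comm 2 n, pow_mul ‖mobiusMap r z‖]
        field_simp

/-- A bound for the weighted `ℓ²`-norm of the coefficients of the extremal function. -/
lemma sum_sq_norm_extremalCoeff_le (hr₀ : 0 < r) (hr₁ : r < 1) (hε : 0 < ε) {S : ℝ}
    (hS : ∀ N : ℕ, ∑ n ∈ Finset.range N, ‖mobiusMap r z‖ ^ (2 * n) /
      (ε ^ 2 + rhoRadius r ^ (2 * n)) ≤ S * ε ^ (2 * gammaExponent r z - 2)) (N : ℕ) :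
    ∑ n ∈ Finset.range N, ‖extremalCoeff r z ε n‖ ^ 2 * (ε ^ 2 + rhoRadius r ^ (2 * n)) ≤
      S * ε ^ 2 := by
  calc _ ≤ ∑ n ∈ Finset.range N, ε ^ (4 - 2 * gammaExponent r z) *
        (‖mobiusMap r z‖ ^ (2 * n) / (ε ^ 2 + rhoRadius r ^ (2 * n))) :=
        Finset.sum_le_sum fun n _ => sq_norm_extremalCoeff_le hr₀ hr₁ hε n
    _ ≤ ε ^ (4 - 2 * gammaExponent r z) * (S * ε ^ (2 * gammaExponent r z - 2)) := by
        rw [← Finset.mul_sum]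
        gcongr
        exact hS N
    _ = S * (ε ^ (4 - 2 * gammaExponent r z) * ε ^ (2 * gammaExponent r z - 2)) := by ring
    _ = S * ε ^ 2 := by
        rw [← Real.rpow_add hε]
        norm_num

/-- Parseval's identity turns a bound for the partial sums of the squared coefficients into a bound
for the `L²`-norm on a circle. -/
lemma setLIntegral_extremalPowerSeries_le (hr₀ : 0 < r) (hr₁ : r < 1) (hε : 0 < ε) {R K : ℝ}
    (hR : 0 ≤ R) (h : ‖mobiusMap r z‖ * R < 1)
    (hK : ∀ N, ∑ n ∈ Finset.range N, ‖extremalCoeff r z ε n‖ ^ 2 * R ^ (2 * n) ≤ K) :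
    ∫⁻ t in Ioc 0 (2 * Real.pi), ‖extremalPowerSeries r z ε (circleMap 0 R t)‖ₑ ^ 2 ≤
      ENNReal.ofReal (2 * Real.pi * K) := by
  obtain ⟨h1, h2⟩ := lintegral_sq_norm_circleMap hR
    (summable_extremalCoeff_mul_pow hr₀ hr₁ hε hR h) (G := extremalPowerSeries r z ε)
    fun w hw => hasSum_extremalPowerSeries hr₀ hr₁ hε (by rwa [hw])
  have h3 := le_of_tendsto' h1.tendsto_sum_nat hK
  rw [div_le_iff₀' (by positivity)] at h3
  exact ENNReal.le_ofReal_iff_toReal_le h2.ne ((ENNReal.toReal_nonneg).trans h3) |>.2 h3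

/-- The single estimate `∑ |bₙ|² (ε² + ρ²ⁿ) ≤ S ε²` controls both norms: dropping `ρ²ⁿ` gives the
Hardy norm, dropping `ε²` the norm on `Γ`. At `z` all terms of the series are nonnegative, so one
term suffices from below. -/
theorem extremalFunction_bounds (hr₀ : 0 < r) (hr₁ : r < 1) (hz : 0 < z.im)
    (hzr : r < dist z Complex.I) :
    ∃ A B c C' : ℝ, 0 < A ∧ 0 < B ∧ 0 < c ∧ 0 < C' ∧ ∀ ε : ℝ, 0 < ε →
      extremalFunction r z ε ∈ hardySpace ∧
      hardyNorm (extremalFunction r z ε) ≤ ENNReal.ofReal A ∧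
      circleL2Norm Complex.I r (extremalFunction r z ε) ≤ ENNReal.ofReal (B * ε) ∧
      ‖extremalFunction r z ε z‖ ≤ C' * ε ^ gammaExponent r z ∧
      (ε ≤ 1 → c * ε ^ gammaExponent r z ≤ ‖extremalFunction r z ε z‖) := by
  have hs := sqrt_one_sub_sq_pos hr₀ hr₁
  have hρ₀ := rhoRadius_pos hr₀ hr₁
  have hρ₁ := rhoRadius_lt_one hr₀ hr₁
  have hz₀ := add_basePoint_ne_zero hr₀ hr₁ hz.le
  have hn₀ : 0 < ‖z + basePoint r‖ := norm_pos_iff.2 hz₀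
  have hγ₀ := gammaExponent_pos hr₀ hr₁ hz hzr
  have hγ₁ := gammaExponent_lt_one hr₀ hr₁ hz hzr
  have hq := rhoRadius_rpow_gammaExponent hr₀ hr₁ hz hzr
  have hq₁ := (norm_mobiusMap_lt_one_iff hr₀ hr₁ hz₀).2 hz
  have hq₀ : 0 < ‖mobiusMap r z‖ := hρ₀.trans (rhoRadius_lt_norm_mobiusMap hr₀ hr₁ hz hzr)
  have hmul : ∀ w : ℂ, ‖w‖ ≤ 1 → ‖mobiusMap r z‖ * ‖w‖ < 1 := fun w hw =>
    mul_lt_one_of_nonneg_of_lt_one_left (norm_nonneg _) hq₁ hw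
  obtain ⟨S, hS₀, hS⟩ := exists_sum_weighted_geometric_le hρ₀ hρ₁ hγ₀ hγ₁ hq
  refine ⟨√(1 / (2 * √(1 - r ^ 2)) * (2 * Real.pi * S)),
    √(r * (1 / (2 * √(1 - r ^ 2) * (1 + √(1 - r ^ 2)))) * (2 * Real.pi * S)),
    ‖mobiusMap r z‖ ^ 2 / 2 / ‖z + basePoint r‖, S / ‖z + basePoint r‖, by positivity,
    by positivity, by positivity, by positivity, fun ε hε => ?_⟩
  have hsum := sum_sq_norm_extremalCoeff_le hr₀ hr₁ hε (hS ε hε)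
  have hhardy : hardyNorm (extremalFunction r z ε) ≤
      ENNReal.ofReal √(1 / (2 * √(1 - r ^ 2)) * (2 * Real.pi * S)) := by
    rw [hardyNorm_le_ofReal_iff (Real.sqrt_nonneg _)]
    intro y hy
    -- The power series converges for `|w| < 1 / |m(z)|`, a disc strictly larger than the unit disc.
    obtain ⟨R, hR₁, hR₂⟩ := exists_between ((one_lt_div hq₀).2 hq₁)
    have hd := differentiableOn_extremalPowerSeries (z := z) hr₀ hr₁ hε (zero_le_one.trans hR₁.le)
      ((lt_div_iff₀' hq₀).1 hR₂)
    calc _ = ∫⁻ x : ℝ, ‖extremalPowerSeries r z ε (mobiusMap r (x + y * Complex.I)) /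
          (x + y * Complex.I + basePoint r)‖ₑ ^ 2 := by
          refine lintegral_congr fun x => ?_
          rw [extremalFunction_eq hr₀ hr₁ hε (hmul _ (le_of_lt ?_))]
          have him : 0 < ((x : ℂ) + y * Complex.I).im := by simpa using hy
          exact (norm_mobiusMap_lt_one_iff hr₀ hr₁ (add_basePoint_ne_zero hr₀ hr₁ him.le)).2 him
      _ ≤ ∫⁻ x : ℝ, ‖extremalPowerSeries r z ε (mobiusMap r x) / (x + basePoint r)‖ₑ ^ 2 :=
          lintegral_line_le hr₀ hr₁ hR₁ hd hy
      _ = ENNReal.ofReal (1 / (2 * √(1 - r ^ 2))) * ∫⁻ t in Ioc 0 (2 * Real.pi),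
          ‖extremalPowerSeries r z ε (circleMap 0 1 t)‖ₑ ^ 2 := by
          rw [← lintegral_comp_mobiusMap hr₀ hr₁ fun w => ‖extremalPowerSeries r z ε w‖ₑ ^ 2]
          exact lintegral_congr fun x =>
            enorm_div_sq _ _ (add_basePoint_ne_zero hr₀ hr₁ (by simp))
      _ ≤ ENNReal.ofReal (1 / (2 * √(1 - r ^ 2))) * ENNReal.ofReal (2 * Real.pi * S) := by
          gcongr
          refine setLIntegral_extremalPowerSeries_le hr₀ hr₁ hε zero_le_one (by simpa) fun N => ?_
          refine le_of_mul_le_mul_right (le_trans ?_ (hsum N)) (pow_pos hε 2)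
          rw [Finset.sum_mul]
          refine Finset.sum_le_sum fun n _ => ?_
          rw [one_pow, mul_one]
          gcongr
          have : 0 < rhoRadius r ^ (2 * n) := by positivity
          linarith
      _ = _ := by
          rw [← ENNReal.ofReal_mul (by positivity), Real.sq_sqrt (by positivity)]
  refine ⟨⟨?_, hhardy.trans_lt ENNReal.ofReal_lt_top⟩, hhardy, ?_, ?_⟩
  · have hd := differentiableOn_extremalPowerSeries (z := z) hr₀ hr₁ hε zero_le_one (by simpa)
    have hm : ∀ ζ ∈ UpperHalfPlane.upperHalfPlaneSet, mobiusMap r ζ ∈ Metric.ball 0 1 :=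
      (bijOn_mobiusMap hr₀ hr₁).mapsTo
    have hne : ∀ ζ ∈ UpperHalfPlane.upperHalfPlaneSet, ζ + basePoint r ≠ 0 := fun ζ hζ =>
      add_basePoint_ne_zero hr₀ hr₁ (le_of_lt hζ)
    have hmd : DifferentiableOn ℂ (mobiusMap r) UpperHalfPlane.upperHalfPlaneSet :=
      DifferentiableOn.fun_div (by fun_prop) (by fun_prop) hne
    refine DifferentiableOn.congr ((hd.comp hmd hm).fun_div
      (by fun_prop : DifferentiableOn ℂ (fun ζ => ζ + basePoint r) _) hne) fun ζ hζ => ?_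
    exact extremalFunction_eq hr₀ hr₁ hε (hmul _ (mem_ball_zero_iff.1 (hm ζ hζ)).le)
  · rw [circleL2Norm_le_ofReal_iff (by positivity)]
    have hΓ : ∀ t, circleMap Complex.I r t ∈ Metric.sphere Complex.I r := fun t =>
      circleMap_mem_sphere _ hr₀.le t
    have him := fun t => im_pos_of_mem_sphere hr₁ (hΓ t)
    have hne := fun t => add_basePoint_ne_zero hr₀ hr₁ (him t).le
    calc _ = ENNReal.ofReal r * (ENNReal.ofReal (1 / (2 * √(1 - r ^ 2) * (1 + √(1 - r ^ 2)))) *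
          ∫⁻ t in Ioc 0 (2 * Real.pi),
            ‖extremalPowerSeries r z ε (circleMap 0 (rhoRadius r) t)‖ₑ ^ 2) := by
          rw [← setLIntegral_comp_mobiusMap hr₀ hr₁ fun w => ‖extremalPowerSeries r z ε w‖ₑ ^ 2]
          congr 1
          refine lintegral_congr fun t => ?_
          rw [extremalFunction_eq hr₀ hr₁ hε (hmul _
            ((norm_mobiusMap_lt_one_iff hr₀ hr₁ (hne t)).2 (him t)).le), enorm_div_sq _ _ (hne t)]
      _ ≤ ENNReal.ofReal r * (ENNReal.ofReal (1 / (2 * √(1 - r ^ 2) * (1 + √(1 - r ^ 2)))) *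
          ENNReal.ofReal (2 * Real.pi * (S * ε ^ 2))) := by
          gcongr
          refine setLIntegral_extremalPowerSeries_le hr₀ hr₁ hε hρ₀.le
            (mul_lt_one_of_nonneg_of_lt_one_left hq₀.le hq₁ hρ₁.le) fun N => ?_
          refine le_trans (Finset.sum_le_sum fun n _ => ?_) (hsum N)
          gcongr
          have : 0 < ε ^ 2 := by positivity
          linarith
      _ = _ := by
          rw [← ENNReal.ofReal_mul (by positivity), ← ENNReal.ofReal_mul (by positivity), mul_pow,
            Real.sq_sqrt (by positivity)]
          congr 1
          ring
  · have hterm : ∀ n, extremalTerm r z ε z n = ((‖mobiusMap r z‖ ^ (2 * n) /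
        (ε ^ 2 + rhoRadius r ^ (2 * n)) : ℝ) : ℂ) := fun n => by
      rw [extremalTerm, Complex.conj_mul', ← pow_mul]
      push_cast
      rfl
    have hsm := summable_extremalTerm hr₀ hr₁ hz hε hz
    simp only [hterm] at hsm
    rw [Complex.summable_ofReal] at hsm
    have hM : ‖extremalFunction r z ε z‖ = ε ^ (2 - gammaExponent r z) / ‖z + basePoint r‖ *
        ∑' n : ℕ, ‖mobiusMap r z‖ ^ (2 * (n + 1)) / (ε ^ 2 + rhoRadius r ^ (2 * (n + 1))) := by
      rw [extremalFunction]
      simp only [hterm]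
      rw [← Complex.ofReal_tsum, norm_mul, norm_div, Complex.norm_real, Complex.norm_real,
        Real.norm_of_nonneg (by positivity),
        Real.norm_of_nonneg (tsum_nonneg fun n => by positivity)]
    have hpow : ε ^ gammaExponent r z =
        ε ^ (2 - gammaExponent r z) * ε ^ (2 * gammaExponent r z - 2) := by
      rw [← Real.rpow_add hε]; congr 1; ring
    rw [hM, hpow]
    constructor
    · have : ∑' n : ℕ, ‖mobiusMap r z‖ ^ (2 * (n + 1)) / (ε ^ 2 + rhoRadius r ^ (2 * (n + 1))) ≤
          S * ε ^ (2 * gammaExponent r z - 2) := by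
        refine hsm.tsum_le_of_sum_range_le fun N => le_trans ?_ (hS ε hε (N + 1))
        rw [Finset.sum_range_succ']
        exact le_add_of_nonneg_right (by positivity)
      calc _ ≤ ε ^ (2 - gammaExponent r z) / ‖z + basePoint r‖ *
            (S * ε ^ (2 * gammaExponent r z - 2)) := by gcongr
        _ = _ := by ring
    · intro hε₁
      obtain ⟨n, hn⟩ := exists_weighted_geometric_ge hρ₀ hρ₁ hγ₀ hq hε hε₁
      calc _ = ε ^ (2 - gammaExponent r z) / ‖z + basePoint r‖ *
            (‖mobiusMap r z‖ ^ 2 / 2 * ε ^ (2 * gammaExponent r z - 2)) := by ring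
        _ ≤ _ := by
          gcongr
          exact hn.trans (hsm.le_tsum n fun j _ => by positivity)

end Extremal

/-! ### Taylor coefficients, Bessel and Cauchy–Schwarz. -/

section TaylorCoefficients

/-- The Taylor coefficients at `0`. -/
def taylorCoeff (g : ℂ → ℂ) (n : ℕ) : ℂ := (n.factorial : ℂ)⁻¹ * iteratedDeriv n g 0

variable {g : ℂ → ℂ}

lemma hasSum_taylorCoeff (hg : DifferentiableOn ℂ g (Metric.ball 0 1)) {w : ℂ} (hw : ‖w‖ < 1) :
    HasSum (fun n => taylorCoeff g n * w ^ n) (g w) := by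
  refine (Complex.hasSum_taylorSeries_on_ball hg (mem_ball_zero_iff.2 hw)).congr_fun fun n => ?_
  simp only [taylorCoeff, smul_eq_mul, sub_zero]
  ring

lemma summable_norm_taylorCoeff (hg : DifferentiableOn ℂ g (Metric.ball 0 1)) {R : ℝ}
    (hR₀ : 0 ≤ R) (hR₁ : R < 1) : Summable fun n => ‖taylorCoeff g n‖ * R ^ n := by
  have h := (hasSum_taylorCoeff hg (w := R) (by simpa [abs_of_nonneg hR₀])).summable.norm
  simpa [abs_of_nonneg hR₀] using h

/-- **Bessel's inequality** on a circle inside the disc of convergence. -/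
lemma sum_taylorCoeff_le_lintegral (hg : DifferentiableOn ℂ g (Metric.ball 0 1)) {R : ℝ}
    (hR₀ : 0 ≤ R) (hR₁ : R < 1) (N : ℕ) :
    ENNReal.ofReal (2 * Real.pi * ∑ n ∈ Finset.range N, ‖taylorCoeff g n‖ ^ 2 * R ^ (2 * n)) ≤
      ∫⁻ t in Ioc 0 (2 * Real.pi), ‖g (circleMap 0 R t)‖ₑ ^ 2 := by
  obtain ⟨h1, h2⟩ := lintegral_sq_norm_circleMap hR₀ (summable_norm_taylorCoeff hg hR₀ hR₁)
    fun w hw => hasSum_taylorCoeff hg (hw.trans_lt hR₁)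
  have h3 := sum_le_hasSum (Finset.range N) (fun n _ => by positivity) h1
  rw [le_div_iff₀' (by positivity)] at h3
  exact ENNReal.ofReal_le_of_le_toReal h3

/-- Bessel's inequality on the unit circle for a bounded analytic function whose boundary values
are attained except at the point `1`. -/
lemma sum_taylorCoeff_le_lintegral_unit (hg : DifferentiableOn ℂ g (Metric.ball 0 1)) {B : ℝ}
    (hB : ∀ w, ‖w‖ ≤ 1 → w ≠ 1 → ‖g w‖ ≤ B) (hc : ContinuousOn g (Metric.closedBall 0 1 \ {1}))
    (N : ℕ) :
    ENNReal.ofReal (2 * Real.pi * ∑ n ∈ Finset.range N, ‖taylorCoeff g n‖ ^ 2) ≤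
      ∫⁻ t in Ioc 0 (2 * Real.pi), ‖g (circleMap 0 1 t)‖ₑ ^ 2 := by
  have hone : ∀ᶠ R : ℝ in 𝓝[<] 1, 0 < R ∧ R < 1 :=
    (eventually_nhdsWithin_of_eventually_nhds (eventually_gt_nhds one_pos)).and
      self_mem_nhdsWithin
  have hnorm : ∀ R t : ℝ, 0 < R → ‖circleMap 0 R t‖ = R := fun R t hR => by
    simp [abs_of_pos hR]
  have hlt : ∀ R t : ℝ, 0 < R ∧ R < 1 → circleMap 0 R t ∈ Metric.ball (0 : ℂ) 1 :=
    fun R t hR => by rw [mem_ball_zero_iff, hnorm R t hR.1]; exact hR.2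
  have hlim : Tendsto (fun R : ℝ => ∫⁻ t in Ioc 0 (2 * Real.pi), ‖g (circleMap 0 R t)‖ₑ ^ 2)
      (𝓝[<] 1) (𝓝 (∫⁻ t in Ioc 0 (2 * Real.pi), ‖g (circleMap 0 1 t)‖ₑ ^ 2)) := by
    refine tendsto_lintegral_filter_of_dominated_convergence (fun _ => ENNReal.ofReal B ^ 2)
      (hone.mono fun R hR => ?_) (hone.mono fun R hR => Eventually.of_forall fun t => ?_)
      (by simp [ENNReal.mul_eq_top]) ?_
    · exact (hg.continuousOn.comp_continuous (continuous_circleMap 0 R)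
        fun t => hlt R t hR).measurable.enorm.pow_const 2
    · gcongr
      rw [← ofReal_norm]
      refine ENNReal.ofReal_le_ofReal (hB _ ((hnorm R t hR.1).trans_le hR.2.le) fun h => ?_)
      have := hnorm R t hR.1
      rw [h, norm_one] at this
      linarith [hR.2]
    -- Passing to the open interval discards `t = 2π`, the only parameter with `w = 1`, the image of
    -- `∞`.
    · rw [← Measure.restrict_congr_set Ioo_ae_eq_Ioc, ae_restrict_iff' measurableSet_Ioo]
      refine Eventually.of_forall fun t ht => ?_
      have hne : circleMap 0 1 t ≠ 1 := fun h => by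
        have h' : Complex.exp (t * Complex.I) = 1 := by simpa [circleMap] using h
        obtain ⟨n, hn⟩ := Complex.exp_eq_one_iff.1 h'
        have hn' : t = n * (2 * Real.pi) := by
          have := congrArg Complex.im hn
          simpa using this
        have h0 : (0 : ℝ) < n := by
          by_contra h0
          push Not at h0
          nlinarith [ht.1, Real.pi_pos]
        have h1 : (n : ℝ) < 1 := by
          by_contra h1
          push Not at h1
          nlinarith [ht.2, Real.pi_pos]
        norm_cast at h0 h1
        omega
      have hct : ContinuousWithinAt g (Metric.closedBall 0 1 \ {1}) (circleMap 0 1 t) :=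
        hc _ ⟨circleMap_mem_closedBall 0 zero_le_one t, hne⟩
      have hmap : Tendsto (fun R : ℝ => circleMap 0 R t) (𝓝[<] 1)
          (𝓝[Metric.closedBall 0 1 \ {1}] (circleMap 0 1 t)) := by
        refine tendsto_nhdsWithin_iff.2 ⟨?_, hone.mono fun R hR => ⟨?_, fun h => ?_⟩⟩
        · refine Tendsto.mono_left (Continuous.tendsto ?_ 1) nhdsWithin_le_nhds
          unfold circleMap
          fun_prop
        · exact Metric.ball_subset_closedBall (hlt R t hR)
        · have := hlt R t hR
          rw [mem_singleton_iff.1 h] at this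
          simp at this
      exact ENNReal.Tendsto.pow ((continuous_enorm.tendsto _).comp (hct.tendsto.comp hmap))
  have hsum : Tendsto (fun R : ℝ => ENNReal.ofReal
      (2 * Real.pi * ∑ n ∈ Finset.range N, ‖taylorCoeff g n‖ ^ 2 * R ^ (2 * n))) (𝓝[<] 1)
      (𝓝 (ENNReal.ofReal (2 * Real.pi * ∑ n ∈ Finset.range N, ‖taylorCoeff g n‖ ^ 2))) := by
    have : Continuous fun R : ℝ => ENNReal.ofReal
      (2 * Real.pi * ∑ n ∈ Finset.range N, ‖taylorCoeff g n‖ ^ 2 * R ^ (2 * n)) :=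
      ENNReal.continuous_ofReal.comp (by fun_prop)
    simpa using (this.tendsto 1).mono_left nhdsWithin_le_nhds
  exact le_of_tendsto_of_tendsto hsum hlim
    (hone.mono fun R hR => sum_taylorCoeff_le_lintegral hg hR.1.le hR.2 N)

/-- The Cauchy–Schwarz estimate of a power series with small weighted coefficients. -/
lemma norm_le_of_sum_taylorCoeff_le (hg : DifferentiableOn ℂ g (Metric.ball 0 1)) {w : ℂ}
    (hw : ‖w‖ < 1) {ρ ε K L : ℝ} (hρ : 0 < ρ)
    (hK : ∀ N, ∑ n ∈ Finset.range N, ‖taylorCoeff g n‖ ^ 2 * (ε ^ 2 + ρ ^ (2 * n)) ≤ K)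
    (hL : ∀ N, ∑ n ∈ Finset.range N, ‖w‖ ^ (2 * n) / (ε ^ 2 + ρ ^ (2 * n)) ≤ L) :
    ‖g w‖ ≤ √(K * L) := by
  refine le_of_tendsto (hasSum_taylorCoeff hg hw).tendsto_sum_nat.norm
    (Eventually.of_forall fun N => (norm_sum_le _ _).trans (Real.le_sqrt_of_sq_le ?_))
  have hd : ∀ n : ℕ, 0 < ε ^ 2 + ρ ^ (2 * n) := fun n => by positivity
  have hL₀ : 0 ≤ L := by simpa using hL 0
  have hK₀ : 0 ≤ K := by simpa using hK 0
  calc (∑ n ∈ Finset.range N, ‖taylorCoeff g n * w ^ n‖) ^ 2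
      ≤ (∑ n ∈ Finset.range N, ‖taylorCoeff g n‖ ^ 2 * (ε ^ 2 + ρ ^ (2 * n))) *
        ∑ n ∈ Finset.range N, ‖w‖ ^ (2 * n) / (ε ^ 2 + ρ ^ (2 * n)) := by
        refine Finset.sum_sq_le_sum_mul_sum_of_sq_le_mul _ (fun n _ => by positivity)
          (fun n _ => by positivity) fun n _ => le_of_eq ?_
        have := (hd n).ne'
        rw [norm_mul, norm_pow, mul_pow, ← pow_mul, mul_comm n 2]
        field_simp
    _ ≤ K * L := mul_le_mul (hK N) (hL N) (Finset.sum_nonneg fun n _ => by positivity) hK₀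

end TaylorCoefficients

/-! ### The upper bound for regular functions. -/

section UpperBound

variable {r : ℝ} {z : ℂ}

/-- The upper bound for functions that are continuous up to the real line and `O(1 / |ζ|)` at
infinity. -/
lemma exists_bound_of_continuousOn (hr₀ : 0 < r) (hr₁ : r < 1) (hz : 0 < z.im)
    (hzr : r < dist z Complex.I) :
    ∃ C : ℝ, 0 < C ∧ ∀ ε : ℝ, 0 < ε → ∀ f : ℂ → ℂ,
      DifferentiableOn ℂ f UpperHalfPlane.upperHalfPlaneSet →
      ContinuousOn f {ζ | 0 ≤ ζ.im} →
      (∃ B, ∀ ζ : ℂ, 0 ≤ ζ.im → ‖(ζ + basePoint r) * f ζ‖ ≤ B) →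
      ∫⁻ x : ℝ, ‖f x‖ₑ ^ 2 ≤ 1 → circleL2Norm Complex.I r f ≤ ENNReal.ofReal ε →
        ‖f z‖ ≤ C * ε ^ gammaExponent r z := by
  have hs := sqrt_one_sub_sq_pos hr₀ hr₁
  have hρ₀ := rhoRadius_pos hr₀ hr₁
  have hρ₁ := rhoRadius_lt_one hr₀ hr₁
  have hz₀ := add_basePoint_ne_zero hr₀ hr₁ hz.le
  have hn₀ : 0 < ‖z + basePoint r‖ := norm_pos_iff.2 hz₀
  have hγ₀ := gammaExponent_pos hr₀ hr₁ hz hzr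
  have hγ₁ := gammaExponent_lt_one hr₀ hr₁ hz hzr
  have hq := rhoRadius_rpow_gammaExponent hr₀ hr₁ hz hzr
  have hq₁ := (norm_mobiusMap_lt_one_iff hr₀ hr₁ hz₀).2 hz
  obtain ⟨S, hS₀, hS⟩ := exists_sum_weighted_geometric_le hρ₀ hρ₁ hγ₀ hγ₁ hq
  set s := √(1 - r ^ 2) with hsd
  -- The summands are the reciprocals of `2π / (2s)` and `2π r / (2s(1 + s))`, the factors relating
  -- the coefficient sums to the squared norms on the line and on `Γ`.
  set K := s / Real.pi + s * (1 + s) / (r * Real.pi) with hKd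
  refine ⟨√(K * S) / ‖z + basePoint r‖, by positivity, fun ε hε f hfd hfc ⟨B, hB⟩ hf1 hfΓ => ?_⟩
  set g : ℂ → ℂ := fun w => (mobiusInv r w + basePoint r) * f (mobiusInv r w) with hgd
  have hgm : ∀ ζ : ℂ, 0 ≤ ζ.im → g (mobiusMap r ζ) = (ζ + basePoint r) * f ζ := fun ζ hζ => by
    simp only [hgd]
    rw [mobiusInv_mobiusMap hr₀ hr₁ (add_basePoint_ne_zero hr₀ hr₁ hζ)]
  have hgf : ∀ ζ : ℂ, 0 ≤ ζ.im →
      ‖f ζ‖ₑ ^ 2 = ENNReal.ofReal (1 / ‖ζ + basePoint r‖ ^ 2) * ‖g (mobiusMap r ζ)‖ₑ ^ 2 :=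
    fun ζ hζ => by
      have h0 := add_basePoint_ne_zero hr₀ hr₁ hζ
      rw [← enorm_div_sq _ _ h0, hgm ζ hζ, mul_div_cancel_left₀ _ h0]
  have hinvd : DifferentiableOn ℂ (mobiusInv r) {1}ᶜ := fun w hw => by
    have : 1 - w ≠ 0 := sub_ne_zero.2 (Ne.symm hw)
    unfold mobiusInv
    exact (DifferentiableAt.fun_div (by fun_prop) (by fun_prop) this).differentiableWithinAt
  have hgdiff : DifferentiableOn ℂ g (Metric.ball 0 1) := by
    have h1 : DifferentiableOn ℂ (mobiusInv r) (Metric.ball 0 1) := hinvd.mono fun w hw h => by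
      rw [mem_singleton_iff.1 h] at hw; simp at hw
    exact (h1.add_const _).fun_mul
      (hfd.comp h1 fun w hw => mobiusInv_im_pos hr₀ hr₁ (mem_ball_zero_iff.1 hw))
  -- The point `1` corresponds to `∞`; there `mobiusInv` has only the default value of division by
  -- zero.
  have hgcont : ContinuousOn g (Metric.closedBall 0 1 \ {1}) := by
    have h1 : ContinuousOn (mobiusInv r) (Metric.closedBall 0 1 \ {1}) :=
      hinvd.continuousOn.mono fun w hw => hw.2
    exact (h1.add continuousOn_const).mul
      (hfc.comp h1 fun w hw => mobiusInv_im_nonneg hr₀ hr₁ (mem_closedBall_zero_iff.1 hw.1) hw.2)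
  have hgB : ∀ w, ‖w‖ ≤ 1 → w ≠ 1 → ‖g w‖ ≤ B := fun w hw hw1 =>
    hB _ (mobiusInv_im_nonneg hr₀ hr₁ hw hw1)
  have hsum1 : ∀ N, ∑ n ∈ Finset.range N, ‖taylorCoeff g n‖ ^ 2 ≤ s / Real.pi := fun N => by
    have h1 := sum_taylorCoeff_le_lintegral_unit hgdiff hgB hgcont N
    have h2 : ENNReal.ofReal (1 / (2 * s)) *
        ∫⁻ t in Ioc 0 (2 * Real.pi), ‖g (circleMap 0 1 t)‖ₑ ^ 2 ≤ 1 := by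
      rw [← lintegral_comp_mobiusMap hr₀ hr₁ fun w => ‖g w‖ₑ ^ 2]
      refine le_trans (le_of_eq ?_) hf1
      exact lintegral_congr fun x => (hgf x (by simp)).symm
    have h3 := (mul_le_mul_right h1 (ENNReal.ofReal (1 / (2 * s)))).trans h2
    rw [← ENNReal.ofReal_mul (by positivity), ENNReal.ofReal_le_one] at h3
    rw [le_div_iff₀ Real.pi_pos]
    field_simp at h3
    linarith
  have hsum2 : ∀ N, ∑ n ∈ Finset.range N, ‖taylorCoeff g n‖ ^ 2 * rhoRadius r ^ (2 * n) ≤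
      s * (1 + s) / (r * Real.pi) * ε ^ 2 := fun N => by
    have h1 := sum_taylorCoeff_le_lintegral hgdiff hρ₀.le hρ₁ N
    rw [circleL2Norm_le_ofReal_iff hε.le] at hfΓ
    have h2 : ENNReal.ofReal r * (ENNReal.ofReal (1 / (2 * s * (1 + s))) *
        ∫⁻ t in Ioc 0 (2 * Real.pi), ‖g (circleMap 0 (rhoRadius r) t)‖ₑ ^ 2) ≤
          ENNReal.ofReal (ε ^ 2) := by
      rw [← setLIntegral_comp_mobiusMap hr₀ hr₁ fun w => ‖g w‖ₑ ^ 2]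
      refine le_trans (le_of_eq ?_) hfΓ
      congr 1
      exact lintegral_congr fun t => (hgf _
        (im_pos_of_mem_sphere hr₁ (circleMap_mem_sphere _ hr₀.le t)).le).symm
    have h3 := (mul_le_mul_right (mul_le_mul_right h1 (ENNReal.ofReal (1 / (2 * s * (1 + s)))))
      (ENNReal.ofReal r)).trans h2
    rw [← ENNReal.ofReal_mul (by positivity), ← ENNReal.ofReal_mul (by positivity),
      ENNReal.ofReal_le_ofReal_iff (by positivity)] at h3
    field_simp at h3 ⊢
    linarith
  have hsum : ∀ N, ∑ n ∈ Finset.range N, ‖taylorCoeff g n‖ ^ 2 *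
      (ε ^ 2 + rhoRadius r ^ (2 * n)) ≤ K * ε ^ 2 := fun N => by
    simp only [mul_add, Finset.sum_add_distrib]
    rw [← Finset.sum_mul, hKd, add_mul]
    gcongr
    · exact hsum1 N
    · exact hsum2 N
  have key := norm_le_of_sum_taylorCoeff_le hgdiff hq₁ hρ₀ hsum (hS ε hε)
  have hpow : K * ε ^ 2 * (S * ε ^ (2 * gammaExponent r z - 2)) =
      K * S * (ε ^ gammaExponent r z) ^ 2 := by
    rw [← Real.rpow_natCast (ε ^ gammaExponent r z), ← Real.rpow_mul hε.le, Real.rpow_sub hε]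
    norm_num [mul_comm (gammaExponent r z)]
    field_simp
  rw [hpow, Real.sqrt_mul (by positivity), Real.sqrt_sq (by positivity), hgm z hz.le, norm_mul]
    at key
  rw [div_mul_eq_mul_div, le_div_iff₀' hn₀]
  exact key

end UpperBound

/-! ### Boundedness away from the real line. -/

section AreaMeanValue

lemma measurable_indicator_ball_enorm_sq {f : ℂ → ℂ} {ζ : ℂ} {R : ℝ}
    (hf : DifferentiableOn ℂ f (Metric.ball ζ R)) :
    Measurable ((Metric.ball 0 R).indicator fun p => ‖f (ζ + p)‖ₑ ^ 2) := by
  classical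
  have hmaps : ∀ p ∈ Metric.ball (0 : ℂ) R, ζ + p ∈ Metric.ball ζ R := fun p hp => by
    simpa using hp
  have h1 : Measurable ((Metric.ball (0 : ℂ) R).indicator fun p => f (ζ + p)) := by
    rw [← piecewise_eq_indicator]
    exact (hf.continuousOn.comp (by fun_prop) hmaps).measurable_piecewise continuousOn_const
      Metric.isOpen_ball.measurableSet
  convert h1.enorm.pow_const 2 using 1
  ext p
  by_cases hp : p ∈ Metric.ball (0 : ℂ) R
  · simp only [indicator_of_mem hp]
  · simp [indicator_of_notMem hp]

/-- The area mean value inequality for `|f|²`. -/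
lemma enorm_sq_mul_le_lintegral_ball {f : ℂ → ℂ} {ζ : ℂ} {R : ℝ} (hR : 0 < R)
    (hf : DifferentiableOn ℂ f (Metric.ball ζ R)) :
    ‖f ζ‖ₑ ^ 2 * ENNReal.ofReal (Real.pi * R ^ 2) ≤
      ∫⁻ p, (Metric.ball 0 R).indicator (fun p => ‖f (ζ + p)‖ₑ ^ 2) p := by
  set F : ℂ → ℝ≥0∞ := (Metric.ball 0 R).indicator (fun p => ‖f (ζ + p)‖ₑ ^ 2) with hF
  have hFm : Measurable F := measurable_indicator_ball_enorm_sq hf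
  have hmean : ∀ t ∈ Ioo 0 R, ‖f ζ‖ₑ ^ 2 * ENNReal.ofReal (2 * Real.pi * t) ≤
      ENNReal.ofReal t * ∫⁻ θ in Ioo (-Real.pi) Real.pi, F (circleMap 0 t θ) := fun t ht => by
    have hsub : closure (Metric.ball ζ |t|) ⊆ Metric.ball ζ R := by
      rw [abs_of_pos ht.1, closure_ball _ ht.1.ne']
      exact Metric.closedBall_subset_ball ht.2
    have h1 := enorm_le_circle_lintegral (H := fun w => f w ^ 2) (c := ζ) (R := t)
      ((hf.mono hsub).fun_pow 2).diffContOnCl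
    simp only [enorm_pow] at h1
    have h2 := setLIntegral_circleMap_add 0 t 0 (-Real.pi) F
    simp only [add_zero] at h2
    rw [show -Real.pi + 2 * Real.pi = Real.pi by ring, ← setLIntegral_congr Ioo_ae_eq_Ioc] at h2
    have h3 : ∀ θ, F (circleMap 0 t θ) = ‖f (circleMap ζ t θ)‖ₑ ^ 2 := fun θ => by
      have hmem : circleMap 0 t θ ∈ Metric.ball (0 : ℂ) R := by
        simpa [abs_of_pos ht.1] using ht.2
      rw [hF, indicator_of_mem hmem]
      simp [circleMap]
    rw [h2]
    simp only [h3]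
    calc _ ≤ ENNReal.ofReal (1 / (2 * Real.pi)) *
          (∫⁻ θ in Ioc 0 (2 * Real.pi), ‖f (circleMap ζ t θ)‖ₑ ^ 2) *
          ENNReal.ofReal (2 * Real.pi * t) := by gcongr
      _ = _ := by
        rw [mul_right_comm, ← ENNReal.ofReal_mul (by positivity)]
        congr 2
        field_simp
  calc ‖f ζ‖ₑ ^ 2 * ENNReal.ofReal (Real.pi * R ^ 2)
      = ∫⁻ t in Ioo 0 R, ‖f ζ‖ₑ ^ 2 * ENNReal.ofReal (2 * Real.pi * t) := by
        rw [lintegral_const_mul _ (by fun_prop), ← ofReal_integral_eq_lintegral_ofReal]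
        · congr 2
          rw [← integral_Ioc_eq_integral_Ioo, ← intervalIntegral.integral_of_le hR.le,
            intervalIntegral.integral_const_mul, integral_id]
          ring
        · exact (Continuous.integrableOn_Icc (by fun_prop)).mono_set Ioo_subset_Icc_self
        · refine (ae_restrict_iff' measurableSet_Ioo).2 (Eventually.of_forall fun t ht => ?_)
          have := ht.1
          simp only [Pi.zero_apply]
          positivity
    _ ≤ ∫⁻ t in Ioo 0 R, ENNReal.ofReal t *
          ∫⁻ θ in Ioo (-Real.pi) Real.pi, F (circleMap 0 t θ) :=
        setLIntegral_mono' measurableSet_Ioo hmean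
    _ ≤ ∫⁻ t in Ioi 0, ENNReal.ofReal t *
          ∫⁻ θ in Ioo (-Real.pi) Real.pi, F (circleMap 0 t θ) :=
        lintegral_mono_set Ioo_subset_Ioi_self
    _ = ∫⁻ p, F p := by
        rw [← Complex.lintegral_comp_polarCoord_symm, polarCoord_target, Measure.volume_eq_prod,
          ← Measure.prod_restrict, lintegral_prod]
        · refine lintegral_congr fun t => ?_
          rw [← lintegral_const_mul' _ _ ENNReal.ofReal_ne_top]
          refine lintegral_congr fun θ => ?_
          rw [smul_eq_mul, Complex.polarCoord_symm_apply, circleMap, Complex.exp_mul_I, zero_add,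
            ← Complex.ofReal_cos, ← Complex.ofReal_sin]
        · have hpm : Measurable fun p : ℝ × ℝ => Complex.polarCoord.symm p := by
            simp only [Complex.polarCoord_symm_apply]
            fun_prop
          have h1 : Measurable fun p : ℝ × ℝ => ENNReal.ofReal p.1 := by fun_prop
          exact (h1.smul (hFm.comp hpm)).aemeasurable

/-- A function with `L²`-bounded restrictions to horizontal lines is bounded on every half-plane
`δ ≤ Im ζ` with `δ > 0`. -/
lemma exists_norm_le_of_hardyNorm_le_one {f : ℂ → ℂ}
    (hf : DifferentiableOn ℂ f UpperHalfPlane.upperHalfPlaneSet) (h1 : hardyNorm f ≤ 1) {δ : ℝ}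
    (hδ : 0 < δ) : ∃ B : ℝ, ∀ ζ : ℂ, δ ≤ ζ.im → ‖f ζ‖ ≤ B := by
  rw [← ENNReal.ofReal_one, hardyNorm_le_ofReal_iff zero_le_one] at h1
  simp only [one_pow, ENNReal.ofReal_one] at h1
  have key : ∀ ζ : ℂ, δ ≤ ζ.im →
      ‖f ζ‖ₑ ^ 2 * ENNReal.ofReal (Real.pi * δ ^ 2) ≤ ENNReal.ofReal (2 * δ) := fun ζ hζ => by
    have hball : ∀ p : ℂ, ‖p‖ < δ → |p.im| < δ := fun p hp => (Complex.abs_im_le_norm p).trans_lt hp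
    have hd : DifferentiableOn ℂ f (Metric.ball ζ δ) := hf.mono fun p hp => by
      have := (abs_lt.1 (hball _ (mem_ball_iff_norm.1 hp))).1
      rw [Complex.sub_im] at this
      change 0 < p.im
      linarith
    have hm : Measurable fun p : ℝ × ℝ => (Metric.ball 0 δ).indicator (fun p => ‖f (ζ + p)‖ₑ ^ 2)
        (Complex.measurableEquivRealProd.symm p) :=
      (measurable_indicator_ball_enorm_sq hd).comp Complex.measurableEquivRealProd.symm.measurable
    refine (enorm_sq_mul_le_lintegral_ball hδ hd).trans ?_
    rw [← (Complex.volume_preserving_equiv_real_prod.symm).lintegral_comp_emb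
      Complex.measurableEquivRealProd.symm.measurableEmbedding, Measure.volume_eq_prod,
      lintegral_prod_symm' _ hm]
    -- The disc of radius `δ` lies in a strip of height `2δ` inside the half-plane, and each
    -- horizontal line there contributes at most `1`.
    calc _ ≤ ∫⁻ b : ℝ, (Ioo (-δ) δ).indicator (fun _ => 1) b := by
          refine lintegral_mono fun b => ?_
          by_cases hb : b ∈ Ioo (-δ) δ
          · rw [indicator_of_mem hb]
            have hpos : 0 < ζ.im + b := by linarith [hb.1]
            refine le_trans ?_ (h1 _ hpos)
            rw [← lintegral_add_right_eq_self
              (fun x : ℝ => ‖f (x + ((ζ.im + b : ℝ) : ℂ) * Complex.I)‖ₑ ^ 2) ζ.re]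
            refine lintegral_mono fun a => (indicator_le_self _ _ _).trans (le_of_eq ?_)
            congr 3
            apply Complex.ext <;> simp [Complex.measurableEquivRealProd, add_comm]
          · rw [indicator_of_notMem hb]
            refine le_of_eq (lintegral_eq_zero_of_ae_eq_zero (Eventually.of_forall fun a => ?_))
            refine indicator_of_notMem (fun h => hb ?_) _
            have := hball _ (mem_ball_zero_iff.1 h)
            rw [abs_lt] at this
            simpa [Complex.measurableEquivRealProd] using this
      _ = ENNReal.ofReal (2 * δ) := by
          rw [lintegral_indicator measurableSet_Ioo]
          simp [two_mul]
  refine ⟨√(2 * δ / (Real.pi * δ ^ 2)), fun ζ hζ => Real.le_sqrt_of_sq_le ?_⟩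
  have h2 := key ζ hζ
  rw [← ofReal_norm, ← ENNReal.ofReal_pow (norm_nonneg _), ← ENNReal.ofReal_mul (by positivity),
    ENNReal.ofReal_le_ofReal_iff (by positivity)] at h2
  rwa [le_div_iff₀ (by positivity)]

end AreaMeanValue

/-! ### Removing the regularity assumptions. -/

section Regularization

variable {r : ℝ} {z : ℂ}

/-- Shifting into the half-plane and damping at infinity. -/
def regularize (f : ℂ → ℂ) (δ : ℝ) (ζ : ℂ) : ℂ :=
  f (ζ + δ * Complex.I) * (Complex.I / (δ * ζ + Complex.I))

lemma one_le_norm_damping {δ : ℝ} (hδ : 0 ≤ δ) {ζ : ℂ} (hζ : 0 ≤ ζ.im) :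
    1 ≤ ‖δ * ζ + Complex.I‖ := by
  refine le_trans ?_ ((le_abs_self _).trans (Complex.abs_im_le_norm _))
  simp
  positivity

lemma norm_regularize_le (f : ℂ → ℂ) {δ : ℝ} (hδ : 0 ≤ δ) {ζ : ℂ} (hζ : 0 ≤ ζ.im) :
    ‖regularize f δ ζ‖ ≤ ‖f (ζ + δ * Complex.I)‖ := by
  rw [regularize, norm_mul, norm_div, Complex.norm_I]
  exact mul_le_of_le_one_right (norm_nonneg _)
    (div_le_one_of_le₀ (one_le_norm_damping hδ hζ) (norm_nonneg _))

lemma differentiableAt_regularize {f : ℂ → ℂ}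
    (hf : DifferentiableOn ℂ f UpperHalfPlane.upperHalfPlaneSet) {δ : ℝ} (hδ : 0 < δ) {ζ : ℂ}
    (hζ : 0 ≤ ζ.im) : DifferentiableAt ℂ (regularize f δ) ζ := by
  have h1 : DifferentiableAt ℂ f (ζ + δ * Complex.I) :=
    hf.differentiableAt (UpperHalfPlane.isOpen_upperHalfPlaneSet.mem_nhds
      (by simp [UpperHalfPlane.upperHalfPlaneSet]; positivity))
  have h2 : DifferentiableAt ℂ (fun ζ => f (ζ + δ * Complex.I)) ζ :=
    h1.comp ζ (by fun_prop : DifferentiableAt ℂ (fun ζ => ζ + δ * Complex.I) ζ)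
  have h3 : (δ : ℂ) * ζ + Complex.I ≠ 0 :=
    norm_pos_iff.1 (one_pos.trans_le (one_le_norm_damping hδ.le hζ))
  exact h2.fun_mul (DifferentiableAt.fun_div (by fun_prop) (by fun_prop) h3)

lemma tendsto_regularize {f : ℂ → ℂ} (hf : DifferentiableOn ℂ f UpperHalfPlane.upperHalfPlaneSet)
    {ζ : ℂ} (hζ : 0 < ζ.im) :
    Tendsto (fun δ : ℝ => regularize f δ ζ) (𝓝[>] 0) (𝓝 (f ζ)) := by
  refine Tendsto.mono_left ?_ nhdsWithin_le_nhds
  have hc : ContinuousAt f (ζ + (0 : ℝ) * Complex.I) := by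
    rw [Complex.ofReal_zero, zero_mul, add_zero]
    exact (hf.differentiableAt (UpperHalfPlane.isOpen_upperHalfPlaneSet.mem_nhds hζ)).continuousAt
  have h1 : ContinuousAt (fun δ : ℝ => f (ζ + δ * Complex.I)) 0 :=
    hc.comp (f := fun δ : ℝ => ζ + δ * Complex.I) (by fun_prop)
  have h2 : ContinuousAt (fun δ : ℝ => Complex.I / (δ * ζ + Complex.I)) 0 :=
    ContinuousAt.div (by fun_prop) (by fun_prop) (by simp)
  have h3 : Tendsto (fun δ : ℝ => regularize f δ ζ) (𝓝 0) (𝓝 _) := (h1.mul h2).tendsto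
  simpa [regularize] using h3

/-- The damping factor has modulus at most one, so the boundary norm of `regularize f δ` is at most
the norm of `f` on the line at height `δ`. The upward shift might increase the norm on `Γ`, but `Γ`
stays at height at least `1 - r`, where `f` is bounded, so dominated convergence applies there. -/
theorem exists_bound (hr₀ : 0 < r) (hr₁ : r < 1) (hz : 0 < z.im) (hzr : r < dist z Complex.I) :
    ∃ C : ℝ, 0 < C ∧ ∀ ε : ℝ, 0 < ε → ∀ f ∈ hardySpace,
      hardyNorm f ≤ 1 → circleL2Norm Complex.I r f ≤ ENNReal.ofReal ε →
        ‖f z‖ ≤ C * ε ^ gammaExponent r z := by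
  obtain ⟨C, hC₀, hC⟩ := exists_bound_of_continuousOn hr₀ hr₁ hz hzr
  refine ⟨C * 2 ^ gammaExponent r z, by positivity, fun ε hε f hf hf1 hfΓ => ?_⟩
  have hfd := hf.1
  have hpos : ∀ᶠ δ : ℝ in 𝓝[>] 0, 0 < δ := self_mem_nhdsWithin
  have him := fun t => im_pos_of_mem_sphere hr₁ (circleMap_mem_sphere Complex.I hr₀.le t)
  have hlim : Tendsto (fun δ : ℝ => ENNReal.ofReal r * ∫⁻ t in Ioc 0 (2 * Real.pi),
      ‖regularize f δ (circleMap Complex.I r t)‖ₑ ^ 2) (𝓝[>] 0)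
      (𝓝 (ENNReal.ofReal r * ∫⁻ t in Ioc 0 (2 * Real.pi), ‖f (circleMap Complex.I r t)‖ₑ ^ 2)) := by
    refine ENNReal.Tendsto.const_mul ?_ (Or.inr ENNReal.ofReal_ne_top)
    obtain ⟨B, hB⟩ := exists_norm_le_of_hardyNorm_le_one hfd hf1 (sub_pos.2 hr₁)
    refine tendsto_lintegral_filter_of_dominated_convergence (fun _ => ENNReal.ofReal B ^ 2)
      (hpos.mono fun δ hδ => ?_) (hpos.mono fun δ hδ => Eventually.of_forall fun t => ?_)
      (by simp [ENNReal.mul_eq_top]) (Eventually.of_forall fun t => ?_)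
    · refine (Continuous.measurable ?_).enorm.pow_const 2
      exact continuous_iff_continuousAt.2 fun t =>
        (differentiableAt_regularize hfd hδ (him t).le).continuousAt.comp
          (continuous_circleMap _ _).continuousAt
    · gcongr
      rw [← ofReal_norm]
      refine ENNReal.ofReal_le_ofReal ((norm_regularize_le f hδ.le (him t).le).trans (hB _ ?_))
      have h1 := Complex.abs_im_le_norm (circleMap Complex.I r t - Complex.I)
      rw [mem_sphere_iff_norm.1 (circleMap_mem_sphere Complex.I hr₀.le t), Complex.sub_im,
        Complex.I_im, abs_le] at h1
      simp
      linarith [h1.1]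
    · exact ENNReal.Tendsto.pow ((continuous_enorm.tendsto _).comp (tendsto_regularize hfd (him t)))
  rw [circleL2Norm_le_ofReal_iff hε.le] at hfΓ
  -- The limit is at most `ε²`, so strict room is needed to pass to small `δ`; doubling `ε` costs
  -- only the factor `2^γ` in the constant.
  have hev := hlim.eventually_lt_const (hfΓ.trans_lt
    ((ENNReal.ofReal_lt_ofReal_iff (by positivity)).2
      (by nlinarith : ε ^ 2 < (2 * ε) ^ 2)))
  rw [mul_assoc, ← Real.mul_rpow two_pos.le hε.le]
  refine le_of_tendsto (tendsto_regularize hfd hz).norm ?_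
  filter_upwards [hpos, hev] with δ hδ hδΓ
  refine hC (2 * ε) (by positivity) (regularize f δ)
    (fun ζ hζ => (differentiableAt_regularize hfd hδ (le_of_lt hζ)).differentiableWithinAt)
    (fun ζ hζ => (differentiableAt_regularize hfd hδ hζ).continuousAt.continuousWithinAt) ?_ ?_
    ((circleL2Norm_le_ofReal_iff (by positivity)).2 hδΓ.le)
  · obtain ⟨B, hB⟩ := exists_norm_le_of_hardyNorm_le_one hfd hf1 hδ
    refine ⟨(2 / δ + 1) * B, fun ζ hζ => ?_⟩
    have h1 := one_le_norm_damping hδ.le hζ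
    have h2 : δ * ‖ζ‖ ≤ ‖δ * ζ + Complex.I‖ + 1 := by
      have := norm_sub_le (δ * ζ + Complex.I) Complex.I
      rw [add_sub_cancel_right, norm_mul, Complex.norm_real, Real.norm_of_nonneg hδ.le,
        Complex.norm_I] at this
      exact this
    have h3 : ‖basePoint r‖ ≤ 1 := by
      rw [basePoint, norm_mul, Complex.norm_I, one_mul, Complex.norm_real,
        Real.norm_of_nonneg (Real.sqrt_nonneg _)]
      exact (sqrt_one_sub_sq_lt_one hr₀ hr₁).le
    have h4 : ‖ζ + basePoint r‖ ≤ (2 / δ + 1) * ‖δ * ζ + Complex.I‖ := by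
      refine (norm_add_le _ _).trans ?_
      have : ‖ζ‖ ≤ 2 / δ * ‖δ * ζ + Complex.I‖ := by
        rw [div_mul_eq_mul_div, le_div_iff₀' hδ]
        linarith
      linarith
    have h5 := hB (ζ + δ * Complex.I) (by simpa using hζ)
    rw [regularize, norm_mul, norm_mul, norm_div, Complex.norm_I]
    calc _ ≤ (2 / δ + 1) * ‖δ * ζ + Complex.I‖ * (B * (1 / ‖δ * ζ + Complex.I‖)) := by gcongr
      _ = _ := by field_simp
  · rw [← ENNReal.ofReal_one, hardyNorm_le_ofReal_iff zero_le_one] at hf1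
    refine le_trans (lintegral_mono fun x => ?_) ((hf1 δ hδ).trans (by simp))
    gcongr
    rw [enorm_le_iff_norm_le]
    exact norm_regularize_le f hδ.le (by simp)

end Regularization

/-! ### Normalizing the extremal function. -/

section Optimality

variable {r : ℝ} {z : ℂ}

lemma mem_hardySpace_const_mul {f : ℂ → ℂ} (hf : f ∈ hardySpace) (a : ℂ) :
    (fun ζ => a * f ζ) ∈ hardySpace ∧ hardyNorm (fun ζ => a * f ζ) = ‖a‖ₑ * hardyNorm f := by
  have h : hardyNorm (fun ζ => a * f ζ) = ‖a‖ₑ * hardyNorm f := by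
    simp only [hardyNorm, ENNReal.mul_iSup]
    refine iSup_congr fun y => iSup_congr fun _ => ?_
    exact eLpNorm_const_smul a (fun x : ℝ => f (x + y * Complex.I)) 2 volume
  refine ⟨⟨hf.1.const_mul a, ?_⟩, h⟩
  rw [h]
  exact ENNReal.mul_lt_top enorm_lt_top hf.2

lemma circleL2Norm_const_mul (c : ℂ) (r : ℝ) (f : ℂ → ℂ) (a : ℂ) :
    circleL2Norm c r (fun ζ => a * f ζ) = ‖a‖ₑ * circleL2Norm c r f :=
  eLpNorm_const_smul a (fun t : ℝ => f (circleMap c r t)) 2 _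

/-- Dividing `M` by `max A B`, which does not depend on `ε`, meets both norm constraints and changes
only the constant in the lower bound. -/
theorem exists_extremal (hr₀ : 0 < r) (hr₁ : r < 1) (hz : 0 < z.im) (hzr : r < dist z Complex.I) :
    ∃ c : ℝ, 0 < c ∧ ∀ ε : ℝ, 0 < ε → ε ≤ 1 → ∃ f ∈ hardySpace,
      hardyNorm f ≤ 1 ∧ circleL2Norm Complex.I r f ≤ ENNReal.ofReal ε ∧
        c * ε ^ gammaExponent r z ≤ ‖f z‖ := by
  obtain ⟨A, B, c, _, hA, hB, hc, _, h⟩ := extremalFunction_bounds hr₀ hr₁ hz hzr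
  set K := max A B with hK
  have hK₀ : 0 < K := lt_max_of_lt_left hA
  have hKe : ‖((K⁻¹ : ℝ) : ℂ)‖ₑ = ENNReal.ofReal K⁻¹ := by
    rw [← ofReal_norm, Complex.norm_real, Real.norm_of_nonneg (by positivity)]
  refine ⟨K⁻¹ * c, by positivity, fun ε hε hε₁ => ?_⟩
  obtain ⟨h1, h2, h3, -, h5⟩ := h ε hε
  obtain ⟨h6, h7⟩ := mem_hardySpace_const_mul h1 ((K⁻¹ : ℝ) : ℂ)
  refine ⟨_, h6, ?_, ?_, ?_⟩
  · rw [h7, hKe]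
    refine (mul_le_mul_right h2 _).trans ?_
    rw [← ENNReal.ofReal_mul (by positivity), ENNReal.ofReal_le_one, inv_mul_le_iff₀ hK₀, mul_one]
    exact le_max_left A B
  · rw [circleL2Norm_const_mul, hKe]
    refine (mul_le_mul_right h3 _).trans ?_
    rw [← ENNReal.ofReal_mul (by positivity)]
    refine ENNReal.ofReal_le_ofReal ?_
    rw [inv_mul_le_iff₀ hK₀]
    gcongr
    exact le_max_right A B
  · rw [norm_mul, Complex.norm_real, Real.norm_of_nonneg (by positivity), mul_assoc]
    gcongr
    exact h5 hε₁

end Optimality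

end

theorem mainTheorem2 (r : ℝ) (hr₀ : 0 < r) (hr₁ : r < 1) :
    -- the Möbius map `m` sends the half-plane onto the unit disc and `Γ` onto the circle `|w| = ρ`
    Set.BijOn (mobiusMap r) UpperHalfPlane.upperHalfPlaneSet (Metric.ball 0 1) ∧
    mobiusMap r '' Metric.sphere Complex.I r = Metric.sphere 0 (rhoRadius r) ∧
    ∀ z : ℂ, 0 < z.im → r < dist z Complex.I →
      -- the bound
      (∃ C : ℝ, 0 < C ∧ ∀ ε : ℝ, 0 < ε → ∀ f ∈ hardySpace,
        hardyNorm f ≤ 1 → circleL2Norm Complex.I r f ≤ ENNReal.ofReal ε →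
          ‖f z‖ ≤ C * ε ^ gammaExponent r z) ∧
      -- its asymptotic optimality
      (∃ c : ℝ, 0 < c ∧ ∀ ε : ℝ, 0 < ε → ε ≤ 1 → ∃ f ∈ hardySpace,
        hardyNorm f ≤ 1 ∧ circleL2Norm Complex.I r f ≤ ENNReal.ofReal ε ∧
          c * ε ^ gammaExponent r z ≤ ‖f z‖) ∧
      -- convergence of the series for `M` in the upper half-plane
      (∀ ε : ℝ, 0 < ε → ∀ ζ : ℂ, 0 < ζ.im →
        Summable (fun n : ℕ => extremalTerm r z ε ζ (n + 1))) ∧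
      -- `M` attains the bound, with constants independent of `ε`
      (∃ A B c C' : ℝ, 0 < A ∧ 0 < B ∧ 0 < c ∧ 0 < C' ∧ ∀ ε : ℝ, 0 < ε →
        extremalFunction r z ε ∈ hardySpace ∧
        hardyNorm (extremalFunction r z ε) ≤ ENNReal.ofReal A ∧
        circleL2Norm Complex.I r (extremalFunction r z ε) ≤ ENNReal.ofReal (B * ε) ∧
        ‖extremalFunction r z ε z‖ ≤ C' * ε ^ gammaExponent r z ∧
        (ε ≤ 1 → c * ε ^ gammaExponent r z ≤ ‖extremalFunction r z ε z‖)) := by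
  refine ⟨bijOn_mobiusMap hr₀ hr₁, image_mobiusMap_sphere hr₀ hr₁, fun z hz hzr =>
    ⟨exists_bound hr₀ hr₁ hz hzr, exists_extremal hr₀ hr₁ hz hzr,
      fun ε hε ζ hζ => summable_extremalTerm hr₀ hr₁ hz hε hζ,
      extremalFunction_bounds hr₀ hr₁ hz hzr⟩⟩
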